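/- **Setting.** Let $d\ge 1$ and $\beta,\gamma,K,B>0$. A distribution $P$ of $(X,Y)$ on $[0,1]^d\times\{-1,1\}$ has marginal $\Pi$ (the law of $X$) and regression function $\eta(x)=\mathbb E(Y\mid X=x)$, with $|\eta|\le 1$ on $[0,1]^d$. The version of $\eta$ is regarded as part of the data of $P$, so that the conditional law of a label is defined at every query point. For a measurable $f:[0,1]^d\to\{-1,1\}$ put $R_P(f)=P(Y\ne f(X))$, and let $R_P^*=\inf_f R_P(f)$ over all measurable classifiers. *Hölder class.* $g:\mathbb R^d\to\mathbb R$ belongs to $\Sigma(\beta,K,[0,1]^d)$ if $g$ is $\lfloor\beta\rfloor$ times continuously differentiable and $|g(y)-T_x(y)|\le K\|x-y\|_\infty^{\beta}$ for all $x,y\in[0,1]^d$, where $T_x$ is the Taylor polynomial of $g$ at $x$ of degree $\lfloor\beta\rfloor$. *Dyadic cubes.* For $m\ge1$ let $R_i$, $i\le 2^{dm}$, be the open dyadic subcubes of $[0,1]^d$ of side $2^{-m}$. $\Pi$ is $(u_1,u_2)$-regular ($0<u_1\le u_2<\infty$) if for every $m\ge 1$ it does not charge the complement of $\bigcup_i R_i$,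 and $u_12^{-dm}\le\Pi(R_i)\le u_22^{-dm}$ whenever $R_i\cap\operatorname{supp}\Pi\ne\emptyset$. Let $\mathcal F_m=\{\sum_i\lambda_i I_{R_i}:|\lambda_i|\le1\}$ and let $\bar\eta_m$ be the $L_2(\Pi)$-projection of $\eta$ onto $\mathcal F_m$. A union $A$ of cubes $R_i$ of level $m$ *approximates the decision boundary* if for some $t>0$, with $S_m=\operatorname{supp}\Pi\cap\bigcup_iR_i$, $$\{|\eta|\le t\}\cap S_m\subseteq A\cap S_m\subseteq\{|\eta|\le 3t\}\cap S_m .$$ *The class.* $\mathcal P_U^*(\beta,\gamma)$ (with the fixed constants $B,K$) is the set of all $P$ such that 1. $\Pi(|\eta|\le t)\le Bt^\gamma$ for all $t>0$; 2. $\eta\in\Sigma(\beta,K,[0,1]^d)$; 3. $\Pi$ is $(u_1,u_2)$-regular for some $u_1,u_2$; 4. for some $B_2>0$, for all $m\ge1$ and every union $A$ of cubes of level $m$ that approximates the decision boundary and has $A_\Pi:=A\cap\operatorname{supp}\Pi\neq\emptyset$, $$\int(\eta-\bar\eta_m)^2\,\Pi(dx\mid A_\Pi)\ \ge\ B_2\sup_{x\in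 A_\Pi}|\eta(x)-\bar\eta_m(x)|^2 .$$ The constants $u_1,u_2,B_2$ may depend on $P$. *Active classifiers.* An active classifier with $N$ labels, which knows $\Pi$, draws for $k=1,\dots,N$ a query $X_k\in[0,1]^d$ from a distribution depending measurably on $(X_1,Y_1),\dots,(X_{k-1},Y_{k-1})$, receives $Y_k$ drawn from the conditional law of $Y$ given $X=X_k$ under $P$, and finally outputs a classifier $\hat f_N$ that is a (jointly measurable) function of the data $(X_k,Y_k)_{k\le N}$. The query distributions and the output rule may depend on $\Pi$ in any way. **Theorem.** Let $\beta,\gamma>0$ with $\beta\gamma\le d$, and let $K>0$. There is $B_0$ such that for every $B\ge B_0$ there exist $C>0$ and $N_0$ such that for all $N\ge N_0$ and every active classifier $\hat f_N$ with $N$ labels, $$\sup_{P\in\mathcal P_U^*(\beta,\gamma)}\bigl(\mathbb E\,R_P(\hat f_N)-R_P^*\bigr)\ \ge\ C\,N^{-\frac{\beta(1+\gamma)}{2\beta+d-\beta\gamma}} .$$ -/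

import Mathlib

open MeasureTheory ProbabilityTheory Set

noncomputable section

namespace ActiveLearning

/-- The unit cube `[0,1]^d`, as a subspace of `Fin d → ℝ` (whose norm is the sup norm). -/
abbrev Cube (d : ℕ) : Type := ↥(Set.Icc (0 : Fin d → ℝ) 1)

/-! ### Distributions of a labelled pair

A label in `{-1,1}` is encoded by a Boolean: `true` is `+1` and `false` is `-1`. -/

/-- A probability distribution on `[0,1]^d × {-1,1}`, given by its marginal distribution on the
cube and a version `eta` of its regression function `x ↦ E(Y | X = x) ∈ [-1,1]`. The law of the
pair is `Model.law`. The version `eta` is part of the data, so that the conditional distribution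
of a label is defined at every query point, also outside the support of the marginal. -/
structure Model (d : ℕ) where
  /-- the distribution of the design variable `X` -/
  marginal : Measure (Cube d)
  isProbabilityMeasure_marginal : IsProbabilityMeasure marginal
  /-- the regression function; only its values on the cube enter the law -/
  eta : (Fin d → ℝ) → ℝ
  measurable_eta : Measurable eta
  abs_eta_le_one : ∀ x : Cube d, |eta x| ≤ 1

variable {d : ℕ}

/-- The conditional distribution of the label given `X = x`:
`+1` with probability `(1 + eta x) / 2` and `-1` with probability `(1 - eta x) / 2`. -/
def Model.label (P : Model d) : Kernel (Cube d) Bool where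
  toFun x := ENNReal.ofReal ((1 + P.eta x) / 2) • Measure.dirac true +
    ENNReal.ofReal ((1 - P.eta x) / 2) • Measure.dirac false
  measurable' := by
    have h : Measurable fun x : Cube d => P.eta x := P.measurable_eta.comp measurable_subtype_coe
    refine Measure.measurable_of_measurable_coe _ fun s hs => ?_
    simp only [Measure.coe_add, Measure.coe_smul, Pi.add_apply, Pi.smul_apply, smul_eq_mul]
    exact (((h.const_add 1).div_const 2).ennreal_ofReal.mul_const _).add
      (((h.const_sub 1).div_const 2).ennreal_ofReal.mul_const _)

instance (P : Model d) : IsProbabilityMeasure P.marginal := P.isProbabilityMeasure_marginal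

instance (P : Model d) : IsMarkovKernel P.label := by
  refine ⟨fun x => ⟨?_⟩⟩
  have h := abs_le.1 (P.abs_eta_le_one x)
  change (ENNReal.ofReal ((1 + P.eta x) / 2) • Measure.dirac true +
    ENNReal.ofReal ((1 - P.eta x) / 2) • Measure.dirac false : Measure Bool) univ = 1
  simp only [Measure.coe_add, Measure.coe_smul, Pi.add_apply, Pi.smul_apply, smul_eq_mul,
    measure_univ, mul_one]
  rw [← ENNReal.ofReal_add (by linarith) (by linarith), ← ENNReal.ofReal_one]
  congr 1
  ring

/-- The law of the pair `(X, Y)`. -/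
def Model.law (P : Model d) : Measure (Cube d × Bool) := P.marginal ⊗ₘ P.label

/-- The risk `R_P(f) = P(Y ≠ f(X))` of a classifier `f`. -/
def Model.risk (P : Model d) (f : Cube d → Bool) : ℝ := P.law.real {z | z.2 ≠ f z.1}

/-- The minimal risk `R^*`, the infimum over all measurable classifiers. -/
def Model.bayesRisk (P : Model d) : ℝ := ⨅ f : {f : Cube d → Bool // Measurable f}, P.risk f.1

/-! ### Active classifiers -/

/-- An active classifier with label budget `N`: the `k`-th query point (counted from `0`) is drawn
from a distribution that depends on the `k` labelled points obtained before (only the queries with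
`k < N` are ever used), and after `N` labels a classifier is produced from the data. -/
structure ActiveClassifier (d N : ℕ) where
  /-- the conditional distribution of the query point given the past -/
  query : (k : ℕ) → Kernel (Fin k → Cube d × Bool) (Cube d)
  isMarkovKernel_query : ∀ k, IsMarkovKernel (query k)
  /-- the classifier that is returned -/
  classify : (Fin N → Cube d × Bool) → Cube d → Bool
  measurable_classify : Measurable (Function.uncurry classify)

/-- The joint law of the first `k` labelled points `(X_1,Y_1), …, (X_k,Y_k)` when the query points
are chosen by `A` and the labels are drawn from the conditional distribution under `P`. -/
def ActiveClassifier.dataLaw {N : ℕ} (A : ActiveClassifier d N) (P : Model d) :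
    (k : ℕ) → Measure (Fin k → Cube d × Bool)
  | 0 => Measure.dirac Fin.elim0
  | k + 1 => (A.dataLaw P k ⊗ₘ (A.query k ⊗ₖ Kernel.prodMkLeft (Fin k → Cube d × Bool) P.label)).map
      fun w => Fin.snoc (α := fun _ => Cube d × Bool) w.1 w.2

/-- The expected risk, under `P`, of the classifier returned by `A` after `N` labels. -/
def ActiveClassifier.expectedRisk {N : ℕ} (A : ActiveClassifier d N) (P : Model d) : ℝ :=
  ∫ D, P.risk (A.classify D) ∂(A.dataLaw P N)

/-! ### Smoothness and low noise -/

/-- The Taylor polynomial of degree `k` of `g` at `x`, evaluated at `y`. -/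
def taylorPoly (g : (Fin d → ℝ) → ℝ) (k : ℕ) (x y : Fin d → ℝ) : ℝ :=
  ∑ j ∈ Finset.range (k + 1),
    ((j.factorial : ℝ))⁻¹ * iteratedFDeriv ℝ j g x (fun _ => y - x)

/-- The Hölder class `Σ(β, K, [0,1]^d)`. -/
def IsHolderClass (β K : ℝ) (g : (Fin d → ℝ) → ℝ) : Prop :=
  ContDiff ℝ (⌊β⌋₊ : ℕ) g ∧
    ∀ x ∈ Set.Icc (0 : Fin d → ℝ) 1, ∀ y ∈ Set.Icc (0 : Fin d → ℝ) 1,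
      |g y - taylorPoly g ⌊β⌋₊ x y| ≤ K * ‖x - y‖ ^ β

/-- The low noise condition with exponent `γ` and constant `B`. -/
def Model.LowNoise (P : Model d) (γ B : ℝ) : Prop :=
  ∀ t : ℝ, 0 < t → P.marginal.real {x | |P.eta x| ≤ t} ≤ B * t ^ γ

/-! ### Dyadic partitions and regularity of the marginal -/

/-- The open dyadic cube of side `2^{-m}` with index `i`. -/
def cell (m : ℕ) (i : Fin d → Fin (2 ^ m)) : Set (Cube d) :=
  {x | ∀ j, ((i j : ℕ) : ℝ) / 2 ^ m < x.1 j ∧ x.1 j < (((i j : ℕ) : ℝ) + 1) / 2 ^ m}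

/-- `(u₁, u₂)`-regularity with respect to the dyadic grids. For every `m` the open cubes of level
`m` form a partition up to a null set, i.e. the grid hyperplanes are not charged. -/
def IsRegular (Q : Measure (Cube d)) (u₁ u₂ : ℝ) : Prop :=
  0 < u₁ ∧ u₁ ≤ u₂ ∧ ∀ m : ℕ, 1 ≤ m →
    (∀ᵐ x ∂Q, ∃ i : Fin d → Fin (2 ^ m), x ∈ cell m i) ∧
    ∀ i : Fin d → Fin (2 ^ m), (cell m i ∩ Q.support).Nonempty →
      u₁ * ((2 : ℝ) ^ (d * m))⁻¹ ≤ Q.real (cell m i) ∧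
        Q.real (cell m i) ≤ u₂ * ((2 : ℝ) ^ (d * m))⁻¹

/-! ### Piecewise constant approximation -/

/-- The piecewise constant function with value `c i` on the cube with index `i`. -/
def piecewiseConst (m : ℕ) (c : (Fin d → Fin (2 ^ m)) → ℝ) (x : Cube d) : ℝ :=
  ∑ i, (cell m i).indicator (fun _ => c i) x

/-- `F_m`: the piecewise constant functions of level `m` with coefficients in `[-1,1]`. -/
def pcClass (d m : ℕ) : Set (Cube d → ℝ) :=
  {f | ∃ c : (Fin d → Fin (2 ^ m)) → ℝ, (∀ i, |c i| ≤ 1) ∧ f = piecewiseConst m c}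

/-- `h` is (a version of) the `L₂(Π)`-projection of the regression function onto `F_m`. -/
def Model.IsProjection (P : Model d) (m : ℕ) (h : Cube d → ℝ) : Prop :=
  h ∈ pcClass d m ∧ ∀ f ∈ pcClass d m,
    ∫ x, (P.eta x - h x) ^ 2 ∂P.marginal ≤ ∫ x, (P.eta x - f x) ^ 2 ∂P.marginal

/-- The union of the open cubes of level `m` with index in `I`. Up to the grid hyperplanes, these
are the sets of the σ-algebra generated by `F_m`. -/
def cellUnion (m : ℕ) (I : Set (Fin d → Fin (2 ^ m))) : Set (Cube d) := ⋃ i ∈ I, cell m i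

/-- `A` approximates the decision boundary at level `m`: for some `t > 0`,
`{|eta| ≤ t} ∩ supp ⊆ A ∩ supp ⊆ {|eta| ≤ 3 t} ∩ supp`, where the points of the (null) grid
hyperplanes of level `m`, which belong to no open cube, are disregarded. -/
def Model.ApproximatesBoundary (P : Model d) (m : ℕ) (A : Set (Cube d)) : Prop :=
  ∃ t : ℝ, 0 < t ∧ ∀ x ∈ P.marginal.support ∩ cellUnion m univ,
    (|P.eta x| ≤ t → x ∈ A) ∧ (x ∈ A → |P.eta x| ≤ 3 * t)

/-- The sup norm of `g` over the set `A`. -/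
def supNormOn (g : Cube d → ℝ) (A : Set (Cube d)) : ℝ := ⨆ x : A, |g x.1|

/-- On all sets `A` of `σ(F_m)` that approximate the decision boundary and meet the support, the
conditional `L₂`-error of the projection onto `F_m` dominates `B₂` times its squared sup norm. -/
def Model.SupNormControl (P : Model d) (B₂ : ℝ) : Prop :=
  ∀ m : ℕ, 1 ≤ m → ∀ I : Set (Fin d → Fin (2 ^ m)),
    P.ApproximatesBoundary m (cellUnion m I) →
    (cellUnion m I ∩ P.marginal.support).Nonempty →
    ∀ h : Cube d → ℝ, P.IsProjection m h →
      B₂ * supNormOn (fun x => P.eta x - h x) (cellUnion m I ∩ P.marginal.support) ^ 2 ≤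
        ∫ x, (P.eta x - h x) ^ 2 ∂(P.marginal[|cellUnion m I ∩ P.marginal.support])

/-- The class `P(β, γ)`, with the constants `B` (low noise) and `K` (smoothness). -/
def classP (d : ℕ) (β γ B K : ℝ) : Set (Model d) :=
  {P | P.LowNoise γ B ∧ IsHolderClass β K P.eta}

/-- The subclass `P_U(β, γ)` with regular marginal. -/
def classPU (d : ℕ) (β γ B K : ℝ) : Set (Model d) :=
  {P | P ∈ classP d β γ B K ∧ ∃ u₁ u₂ : ℝ, IsRegular P.marginal u₁ u₂}

/-- The subclass `P_U^*(β, γ)`. -/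
def classPUStar (d : ℕ) (β γ B K : ℝ) : Set (Model d) :=
  {P | P ∈ classPU d β γ B K ∧ ∃ B₂ : ℝ, 0 < B₂ ∧ P.SupNormControl B₂}

end ActiveLearning

end

/-!
# The minimax lower bound for active learning

The proof embeds a hypercube of models with a common marginal into `classPUStar`, and shows by
Assouad's method that few labels cannot determine the vertex of the hypercube.

*The models.* At the dyadic scale `r`, the regression function has `2^(dr)` smooth bumps of width
`2^(-r-1)` and height `a = c 2^(-rβ)`, with arbitrary signs, in one corner of the cube, and one bump
of height `c` in the opposite corner (`regFun`). This height and the disjointness of the supports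
keep the Hölder constant below `K` (`exists_isHolderClass_regFun`). The marginal is a mixture of
uniform distributions on small dyadic cells in the plateaus of the bumps. The small bumps together
get the mass `ε = 2^(-rβγ) / 2`, which is what low noise permits for the value `a` of `|eta|`
(`sum_hardWeight_le`). The large bump takes the rest of the mass away from the decision boundary.
Such mixtures are regular (`isRegular_cellMixture`). As the regression function is constant on each
charged cell, the sup norm condition holds too (`IsCellModel.supNormControl`): at levels coarser
than that of the cells each value of the error is seen by its `L₂`-norm, and at finer levels the
projection is exact on the support. The constants in these two conditions depend on `r`, as the
definition of the class allows; `B` and `K` do not.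

*The information in the labels.* Reversing the sign of one bump changes the label distribution only
on its support, where a label has relative entropy of order `a²`. By the chain rule, the relative
entropy of the data is at most of order `a²` times the expected number of queries in the support
(`integral_neg_log_dataRatio_le`), and this bounds the errors of tests from below
(`integral_add_integral_ge`). The numbers of queries in the supports add up to at most `N`, so most
signs remain undetermined if `N a²` is small compared with `2^(dr)`; the excess risk is then at
least of order `ε a` (`le_sum_excessRisk`). If `2^(rδ)` is of the order of `N`, where
`δ = 2β + d - βγ ≤ 2β + d`, there are this few labels, and `ε a` is of the order of the
claimed rate.
-/

noncomputable section

namespace ActiveLearning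

variable {d : ℕ}

/-! ### Taylor polynomials and the Hölder class -/

/-- Taylor's theorem with a bound on the remainder. -/
lemma abs_sub_taylorPoly_le {g : (Fin d → ℝ) → ℝ} {k : ℕ} (hg : ContDiff ℝ (k + 1) g) {D : ℝ}
    (hD : ∀ z, ‖iteratedFDeriv ℝ (k + 1) g z‖ ≤ D) (x y : Fin d → ℝ) :
    |g y - taylorPoly g k x y| ≤ D * ‖x - y‖ ^ (k + 1) := by
  have hD0 : 0 ≤ D := (norm_nonneg _).trans (hD x)
  have h := map_add_eq_sum_add_integral_iteratedFDeriv (f := g) (x := x) (y := y - x) (n := k)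
    fun t _ => hg.contDiffAt
  rw [add_sub_cancel] at h
  have h' : g y - taylorPoly g k x y = (k.factorial : ℝ)⁻¹ • ∫ t in (0 : ℝ)..1,
      (1 - t) ^ k • iteratedFDeriv ℝ (k + 1) g (x + t • (y - x)) (fun _ => y - x) := by
    rw [h, taylorPoly]
    simp only [smul_eq_mul]
    ring
  have hint : ‖∫ t in (0 : ℝ)..1,
      (1 - t) ^ k • iteratedFDeriv ℝ (k + 1) g (x + t • (y - x)) (fun _ => y - x)‖ ≤
        D * ‖x - y‖ ^ (k + 1) * |1 - 0| := by
    refine intervalIntegral.norm_integral_le_of_norm_le_const fun t ht => ?_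
    rw [uIoc_of_le zero_le_one] at ht
    rw [norm_smul]
    have h1 : ‖(1 - t) ^ k‖ ≤ 1 := by
      rw [norm_pow, Real.norm_eq_abs]
      exact pow_le_one₀ (abs_nonneg _) (abs_le.2 ⟨by linarith [ht.2], by linarith [ht.1]⟩)
    have h2 : ‖iteratedFDeriv ℝ (k + 1) g (x + t • (y - x)) (fun _ => y - x)‖ ≤
        D * ‖x - y‖ ^ (k + 1) := by
      refine (ContinuousMultilinearMap.le_opNorm _ _).trans ?_
      rw [Finset.prod_const, Finset.card_univ, Fintype.card_fin, norm_sub_rev]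
      gcongr
      exact hD _
    calc _ ≤ 1 * (D * ‖x - y‖ ^ (k + 1)) := by gcongr
      _ = _ := one_mul _
  rw [h', smul_eq_mul, abs_mul, abs_of_nonneg (by positivity)]
  have hk : ((k.factorial : ℝ))⁻¹ ≤ 1 :=
    inv_le_one_of_one_le₀ (by exact_mod_cast Nat.one_le_iff_ne_zero.2 k.factorial_ne_zero)
  rw [Real.norm_eq_abs, sub_zero, abs_one, mul_one] at hint
  calc _ ≤ 1 * (D * ‖x - y‖ ^ (k + 1)) := by gcongr
    _ = _ := one_mul _

/-- Bounds on the derivatives up to order `⌊β⌋ + 1` give a Hölder bound of order `β` on the whole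
space: at distances at most one the remainder of order `⌊β⌋ + 1` is small enough, and at distances
at least one all terms of the Taylor polynomial are dominated by `‖x - y‖ ^ β`. -/
lemma abs_sub_taylorPoly_le_rpow {g : (Fin d → ℝ) → ℝ} {β : ℝ} (hβ : 0 < β)
    (hg : ContDiff ℝ (⌊β⌋₊ + 1 : ℕ) g) {D : ℝ}
    (hD : ∀ j ≤ ⌊β⌋₊ + 1, ∀ z, ‖iteratedFDeriv ℝ j g z‖ ≤ D) (x y : Fin d → ℝ) :
    |g y - taylorPoly g ⌊β⌋₊ x y| ≤ (⌊β⌋₊ + 2) * D * ‖x - y‖ ^ β := by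
  have hD0 : 0 ≤ D := (norm_nonneg _).trans (hD 0 (Nat.zero_le _) x)
  rcases le_total ‖x - y‖ 1 with h | h
  · have h1 := abs_sub_taylorPoly_le (by exact_mod_cast hg) (hD _ le_rfl) x y
    have h2 : ‖x - y‖ ^ (⌊β⌋₊ + 1) ≤ ‖x - y‖ ^ β := by
      rw [← Real.rpow_natCast]
      exact Real.rpow_le_rpow_of_exponent_ge' (norm_nonneg _) h hβ.le
        (by push_cast; exact (Nat.lt_floor_add_one β).le)
    calc _ ≤ D * ‖x - y‖ ^ (⌊β⌋₊ + 1) := h1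
      _ ≤ 1 * D * ‖x - y‖ ^ β := by rw [one_mul]; gcongr
      _ ≤ _ := by gcongr; linarith [Nat.cast_nonneg (α := ℝ) ⌊β⌋₊]
  · have h1 : |g y| ≤ D * ‖x - y‖ ^ β := by
      have := hD 0 (Nat.zero_le _) y
      rw [norm_iteratedFDeriv_zero, Real.norm_eq_abs] at this
      exact this.trans (le_mul_of_one_le_right hD0 (Real.one_le_rpow h hβ.le))
    have h2 : |taylorPoly g ⌊β⌋₊ x y| ≤ (⌊β⌋₊ + 1) * (D * ‖x - y‖ ^ β) := by
      unfold taylorPoly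
      refine (Finset.abs_sum_le_sum_abs _ _).trans ?_
      have hc : ∑ _j ∈ Finset.range (⌊β⌋₊ + 1), D * ‖x - y‖ ^ β =
          (⌊β⌋₊ + 1) * (D * ‖x - y‖ ^ β) := by
        rw [Finset.sum_const, Finset.card_range, nsmul_eq_mul, Nat.cast_add_one]
      rw [← hc]
      refine Finset.sum_le_sum fun j hj => ?_
      have hj' : j ≤ ⌊β⌋₊ := Nat.lt_succ_iff.1 (Finset.mem_range.1 hj)
      rw [abs_mul, abs_of_nonneg (by positivity)]
      have hk : ((j.factorial : ℝ))⁻¹ ≤ 1 :=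
        inv_le_one_of_one_le₀ (by exact_mod_cast Nat.one_le_iff_ne_zero.2 j.factorial_ne_zero)
      have h3 : |iteratedFDeriv ℝ j g x (fun _ => y - x)| ≤ D * ‖x - y‖ ^ j := by
        refine ((iteratedFDeriv ℝ j g x).le_opNorm _).trans ?_
        rw [Finset.prod_const, Finset.card_univ, Fintype.card_fin, norm_sub_rev]
        gcongr
        exact hD j (by omega) _
      have h4 : ‖x - y‖ ^ j ≤ ‖x - y‖ ^ β := by
        rw [← Real.rpow_natCast]
        exact Real.rpow_le_rpow_of_exponent_le h
          ((Nat.cast_le.2 hj').trans (Nat.floor_le hβ.le))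
      calc _ ≤ 1 * (D * ‖x - y‖ ^ j) := by gcongr
        _ ≤ _ := by rw [one_mul]; gcongr
    calc _ ≤ |g y| + |taylorPoly g ⌊β⌋₊ x y| := abs_sub _ _
      _ ≤ D * ‖x - y‖ ^ β + (⌊β⌋₊ + 1) * (D * ‖x - y‖ ^ β) := add_le_add h1 h2
      _ = _ := by ring

lemma taylorPoly_comp_smul_sub {g : (Fin d → ℝ) → ℝ} {k : ℕ} (hg : ContDiff ℝ k g) (s : ℝ)
    (v x y : Fin d → ℝ) :
    taylorPoly (fun z => g (s • z - v)) k x y = taylorPoly g k (s • x - v) (s • y - v) := by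
  refine Finset.sum_congr rfl fun j hj => ?_
  have hj' : (j : WithTop ℕ∞) ≤ k := by exact_mod_cast Nat.lt_succ_iff.1 (Finset.mem_range.1 hj)
  have h : iteratedFDeriv ℝ j (fun z => g (s • z - v)) x =
      s ^ j • iteratedFDeriv ℝ j g (s • x - v) := by
    have h1 := iteratedFDeriv_comp_const_smul (i := j) s (f := fun z => g (z - v))
      ((hg.of_le hj').comp (contDiff_id.sub contDiff_const))
    rw [congrFun h1 x, iteratedFDeriv_comp_sub]
  rw [h, sub_sub_sub_cancel_right, ← smul_sub]
  have h2 := (iteratedFDeriv ℝ j g (s • x - v)).map_smul_univ (fun _ => s) (fun _ => y - x)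
  rw [Finset.prod_const, Finset.card_univ, Fintype.card_fin] at h2
  rw [h2]
  rfl

lemma taylorPoly_add {f g : (Fin d → ℝ) → ℝ} {k : ℕ} (hf : ContDiff ℝ k f) (hg : ContDiff ℝ k g)
    (x y : Fin d → ℝ) :
    taylorPoly (fun z => f z + g z) k x y = taylorPoly f k x y + taylorPoly g k x y := by
  simp only [taylorPoly]
  rw [← Finset.sum_add_distrib]
  refine Finset.sum_congr rfl fun j hj => ?_
  have hj' : (j : WithTop ℕ∞) ≤ k := by exact_mod_cast Nat.lt_succ_iff.1 (Finset.mem_range.1 hj)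
  have h := iteratedFDeriv_add_apply (hf.of_le hj').contDiffAt (hg.of_le hj').contDiffAt (x := x)
  rw [← mul_add, ← add_apply, ← h]
  rfl

lemma taylorPoly_const_mul {g : (Fin d → ℝ) → ℝ} {k : ℕ} (hg : ContDiff ℝ k g) (a : ℝ)
    (x y : Fin d → ℝ) :
    taylorPoly (fun z => a * g z) k x y = a * taylorPoly g k x y := by
  simp only [taylorPoly]
  rw [Finset.mul_sum]
  refine Finset.sum_congr rfl fun j hj => ?_
  have hj' : (j : WithTop ℕ∞) ≤ k := by exact_mod_cast Nat.lt_succ_iff.1 (Finset.mem_range.1 hj)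
  have h := iteratedFDeriv_const_smul_apply' (a := a) (hg.of_le hj').contDiffAt (x := x)
  simp only [smul_eq_mul] at h
  rw [h, smul_apply, smul_eq_mul]
  ring

/-! ### The regression functions -/

/-- A smooth bump with values in `[0, 1]`, equal to one on the cube `[1/4, 3/4]^d` and supported in
`[1/8, 7/8]^d` (balls of `Fin d → ℝ` are cubes). -/
def unitBump (d : ℕ) : ContDiffBump (fun _ : Fin d => (1 / 2 : ℝ)) :=
  ⟨1 / 4, 3 / 8, by norm_num, by norm_num⟩

/-- The point of `ℝ^d` with the natural coordinates `i`. -/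
def gridPoint {n : ℕ} (i : Fin d → Fin n) : Fin d → ℝ := fun j => ((i j : ℕ) : ℝ)

/-- Bumps in the unit cubes with lower corner in `{0, …, n - 1}^d`, with coefficients `σ`. -/
def bumpSum {n : ℕ} (σ : (Fin d → Fin n) → ℝ) (z : Fin d → ℝ) : ℝ :=
  ∑ i, σ i * unitBump d (z - gridPoint i)

lemma gridPoint_injective_of_near {n : ℕ} {i i' : Fin d → Fin n} {z : Fin d → ℝ}
    (h : z - gridPoint i ∈ Metric.closedBall (fun _ : Fin d => (1 / 2 : ℝ)) (3 / 8))
    (h' : z - gridPoint i' ∈ Metric.closedBall (fun _ : Fin d => (1 / 2 : ℝ)) (3 / 8)) :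
    i = i' := by
  rw [Metric.mem_closedBall, dist_pi_le_iff (by norm_num)] at h h'
  ext j
  have h1 := abs_le.1 (h j)
  have h2 := abs_le.1 (h' j)
  simp only [Pi.sub_apply, gridPoint] at h1 h2
  have h3 : ((i j : ℕ) : ℝ) < ((i' j : ℕ) : ℝ) + 1 := by linarith [h1.2, h2.1, h1.1, h2.2]
  have h4 : ((i' j : ℕ) : ℝ) < ((i j : ℕ) : ℝ) + 1 := by linarith [h1.2, h2.1, h1.1, h2.2]
  have h5 : (i j : ℕ) < (i' j : ℕ) + 1 := by exact_mod_cast h3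
  have h6 : (i' j : ℕ) < (i j : ℕ) + 1 := by exact_mod_cast h4
  omega

lemma unitBump_eq_zero {z : Fin d → ℝ}
    (h : z ∉ Metric.closedBall (fun _ : Fin d => (1 / 2 : ℝ)) (3 / 8)) : unitBump d z = 0 :=
  (unitBump d).zero_of_le_dist (by
    rw [Metric.mem_closedBall, not_le] at h
    exact h.le)

lemma contDiff_bumpSum {n : ℕ} (σ : (Fin d → Fin n) → ℝ) (k : ℕ) : ContDiff ℝ k (bumpSum σ) :=
  ContDiff.sum fun _ _ => contDiff_const.mul
    ((unitBump d).contDiff.comp (contDiff_id.sub contDiff_const))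

/-- On the cube that carries the bump with index `i`, only this bump contributes. -/
lemma bumpSum_eq_of_near {n : ℕ} (σ : (Fin d → Fin n) → ℝ) {i : Fin d → Fin n} {z : Fin d → ℝ}
    (h : z - gridPoint i ∈ Metric.closedBall (fun _ : Fin d => (1 / 2 : ℝ)) (3 / 8)) :
    bumpSum σ z = σ i * unitBump d (z - gridPoint i) := by
  refine Finset.sum_eq_single i (fun i' _ hi' => ?_) (by simp)
  rw [unitBump_eq_zero fun h' => hi' (gridPoint_injective_of_near h' h), mul_zero]

lemma bumpSum_eq_zero {n : ℕ} (σ : (Fin d → Fin n) → ℝ) {z : Fin d → ℝ}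
    (h : ∀ i : Fin d → Fin n,
      z - gridPoint i ∉ Metric.closedBall (fun _ : Fin d => (1 / 2 : ℝ)) (3 / 8)) :
    bumpSum σ z = 0 :=
  Finset.sum_eq_zero fun i _ => by rw [unitBump_eq_zero (h i), mul_zero]

lemma abs_bumpSum_le {n : ℕ} {σ : (Fin d → Fin n) → ℝ} (hσ : ∀ i, |σ i| ≤ 1) (z : Fin d → ℝ) :
    |bumpSum σ z| ≤ 1 := by
  by_cases h : ∃ i : Fin d → Fin n,
      z - gridPoint i ∈ Metric.closedBall (fun _ : Fin d => (1 / 2 : ℝ)) (3 / 8)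
  · obtain ⟨i, hi⟩ := h
    rw [bumpSum_eq_of_near σ hi, abs_mul, abs_of_nonneg (unitBump d).nonneg]
    exact mul_le_one₀ (hσ i) (unitBump d).nonneg (unitBump d).le_one
  · rw [bumpSum_eq_zero σ (not_exists.1 h), abs_zero]
    exact zero_le_one

lemma exists_bound_iteratedFDeriv_unitBump (d k : ℕ) :
    ∃ D : ℝ, ∀ j ≤ k, ∀ z, ‖iteratedFDeriv ℝ j (unitBump d) z‖ ≤ D := by
  have h (j : ℕ) : ∃ C, ∀ z, ‖iteratedFDeriv ℝ j (unitBump d) z‖ ≤ C :=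
    Continuous.bounded_above_of_compact_support
      (((unitBump d).contDiff (n := j)).continuous_iteratedFDeriv le_rfl)
      ((unitBump d).hasCompactSupport.iteratedFDeriv j)
  choose C hC using h
  refine ⟨∑ j ∈ Finset.range (k + 1), C j, fun j hj z => (hC j z).trans ?_⟩
  exact Finset.single_le_sum (fun i _ => (norm_nonneg _).trans (hC i z))
    (Finset.mem_range.2 (by omega))

/-- As the bumps have disjoint supports, the derivative bounds of a single bump are inherited by
their sum, independently of the number of bumps. -/
lemma norm_iteratedFDeriv_bumpSum_le {n k : ℕ} {D : ℝ}
    (hD : ∀ j ≤ k, ∀ z, ‖iteratedFDeriv ℝ j (unitBump d) z‖ ≤ D)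
    {σ : (Fin d → Fin n) → ℝ} (hσ : ∀ i, |σ i| ≤ 1) {j : ℕ} (hj : j ≤ k) (z : Fin d → ℝ) :
    ‖iteratedFDeriv ℝ j (bumpSum σ) z‖ ≤ D := by
  have hD0 : 0 ≤ D := (norm_nonneg _).trans (hD 0 (Nat.zero_le _) z)
  have hs (i : Fin d → Fin n) : ContDiffAt ℝ j (fun z => unitBump d (z - gridPoint i)) z :=
    ((unitBump d).contDiff.comp (contDiff_id.sub contDiff_const)).contDiffAt
  have h1 : iteratedFDeriv ℝ j (bumpSum σ) z =
      ∑ i, σ i • iteratedFDeriv ℝ j (unitBump d) (z - gridPoint i) := by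
    unfold bumpSum
    rw [iteratedFDeriv_fun_sum_apply fun i _ => contDiffAt_const.mul (hs i)]
    refine Finset.sum_congr rfl fun i _ => ?_
    have := iteratedFDeriv_const_smul_apply' (a := σ i) (hs i)
    simp only [smul_eq_mul] at this
    rw [this, iteratedFDeriv_comp_sub]
  have h0 (i : Fin d → Fin n)
      (hi : z - gridPoint i ∉ Metric.closedBall (fun _ : Fin d => (1 / 2 : ℝ)) (3 / 8)) :
      iteratedFDeriv ℝ j (unitBump d) (z - gridPoint i) = 0 := by
    by_contra hne
    refine hi ?_
    have := support_iteratedFDeriv_subset (𝕜 := ℝ) (f := unitBump d) j (Function.mem_support.2 hne)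
    rwa [(unitBump d).tsupport_eq] at this
  rw [h1]
  by_cases h : ∃ i : Fin d → Fin n,
      z - gridPoint i ∈ Metric.closedBall (fun _ : Fin d => (1 / 2 : ℝ)) (3 / 8)
  · obtain ⟨i, hi⟩ := h
    rw [Finset.sum_eq_single i
      (fun i' _ hi' => by
        rw [h0 i' fun h' => hi' (gridPoint_injective_of_near h' hi), smul_zero]) (by simp),
      norm_smul, Real.norm_eq_abs]
    calc _ ≤ 1 * D := by gcongr; exacts [hσ i, hD j hj _]
      _ = D := one_mul D
  · rw [Finset.sum_eq_zero fun i _ => by rw [h0 i (not_exists.1 h i), smul_zero], norm_zero]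
    exact hD0

/-- The regression function with `2^(dr)` bumps of height `a` and sign pattern `σ` in the corner
`[0, 1/2]^d` of the cube and one bump of height `c` in the opposite corner. -/
def regFun (r : ℕ) (a c : ℝ) (σ : (Fin d → Fin (2 ^ r)) → ℝ) (x : Fin d → ℝ) : ℝ :=
  a * bumpSum σ ((2 : ℝ) ^ (r + 1) • x) + c * unitBump d ((2 : ℝ) • x - 1)

lemma contDiff_regFun (r : ℕ) (a c : ℝ) (σ : (Fin d → Fin (2 ^ r)) → ℝ) (k : ℕ) :
    ContDiff ℝ k (regFun r a c σ) :=
  (contDiff_const.mul ((contDiff_bumpSum σ k).comp (contDiff_id.const_smul _))).add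
    (contDiff_const.mul
      ((unitBump d).contDiff.comp ((contDiff_id.const_smul _).sub contDiff_const)))

/-- The height `2^(-rβ) c` of bumps of width `2^(-r-1)` keeps the Hölder constant bounded, and it is
small for small `c`. -/
lemma exists_isHolderClass_regFun (d : ℕ) {β K : ℝ} (hβ : 0 < β) (hK : 0 < K) :
    ∃ c₀ : ℝ, 0 < c₀ ∧ ∀ c : ℝ, 0 ≤ c → c ≤ c₀ → ∀ (r : ℕ) (σ : (Fin d → Fin (2 ^ r)) → ℝ),
      (∀ i, |σ i| ≤ 1) → IsHolderClass β K (regFun r (c * (2 : ℝ) ^ (-(r * β))) c σ) := by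
  obtain ⟨D, hD⟩ := exists_bound_iteratedFDeriv_unitBump d (⌊β⌋₊ + 1)
  have hD0 : 0 ≤ D := (norm_nonneg _).trans (hD 0 (Nat.zero_le _) 0)
  set L : ℝ := (⌊β⌋₊ + 2) * D with hL
  have hL0 : 0 ≤ L := by positivity
  have hT : 0 < 2 * (2 : ℝ) ^ β * (L + 1) := by positivity
  refine ⟨K / (2 * (2 : ℝ) ^ β * (L + 1)), by positivity, fun c hc hcc r σ hσ =>
    ⟨contDiff_regFun _ _ _ _ _, fun x _ y _ => ?_⟩⟩
  set k := ⌊β⌋₊ with hk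
  set s : ℝ := (2 : ℝ) ^ (r + 1) with hs
  have e1 : (fun z : Fin d → ℝ => bumpSum σ (s • z)) = fun z => bumpSum σ (s • z - 0) := by
    simp only [sub_zero]
  have c1 : ContDiff ℝ k (fun z : Fin d → ℝ => bumpSum σ (s • z)) :=
    (contDiff_bumpSum σ k).comp (contDiff_id.const_smul _)
  have c2 : ContDiff ℝ k (fun z : Fin d → ℝ => unitBump d ((2 : ℝ) • z - 1)) :=
    (unitBump d).contDiff.comp ((contDiff_id.const_smul _).sub contDiff_const)
  have b1 := abs_sub_taylorPoly_le_rpow hβ (contDiff_bumpSum σ _)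
    (fun j hj z => norm_iteratedFDeriv_bumpSum_le hD hσ hj z) (s • x) (s • y)
  have b2 := abs_sub_taylorPoly_le_rpow hβ (unitBump d).contDiff hD ((2 : ℝ) • x - 1)
    ((2 : ℝ) • y - 1)
  rw [← hk, ← hL, ← smul_sub, norm_smul, Real.mul_rpow (norm_nonneg _) (norm_nonneg _),
    Real.norm_of_nonneg (by positivity)] at b1
  rw [← hk, ← hL, sub_sub_sub_cancel_right, ← smul_sub, norm_smul,
    Real.mul_rpow (norm_nonneg _) (norm_nonneg _), Real.norm_of_nonneg (by positivity)] at b2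
  have t1 : taylorPoly (fun z : Fin d → ℝ => bumpSum σ (s • z)) k x y =
      taylorPoly (bumpSum σ) k (s • x) (s • y) := by
    rw [e1, taylorPoly_comp_smul_sub (contDiff_bumpSum σ k), sub_zero, sub_zero]
  have t2 := taylorPoly_comp_smul_sub (unitBump d).contDiff (k := k) (2 : ℝ) 1 x y
  set a := c * (2 : ℝ) ^ (-(r * β)) with ha
  have ha0 : 0 ≤ a := by positivity
  have t3 : taylorPoly (regFun r a c σ) k x y =
      a * taylorPoly (bumpSum σ) k (s • x) (s • y) +
        c * taylorPoly (unitBump d) k ((2 : ℝ) • x - 1) ((2 : ℝ) • y - 1) := by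
    rw [← t1, ← t2, ← taylorPoly_const_mul c1, ← taylorPoly_const_mul c2,
      ← taylorPoly_add (contDiff_const.mul c1) (contDiff_const.mul c2)]
    rfl
  have has : a * s ^ β = c * 2 ^ β := by
    rw [ha, hs, ← Real.rpow_natCast, ← Real.rpow_mul (by norm_num), mul_assoc,
      ← Real.rpow_add (by norm_num)]
    congr 2
    push_cast
    ring
  have hfin : regFun r a c σ y - taylorPoly (regFun r a c σ) k x y =
      a * (bumpSum σ (s • y) - taylorPoly (bumpSum σ) k (s • x) (s • y)) +
      c * (unitBump d ((2 : ℝ) • y - 1) -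
        taylorPoly (unitBump d) k ((2 : ℝ) • x - 1) ((2 : ℝ) • y - 1)) := by
    rw [t3, regFun]
    ring
  rw [hfin]
  clear_value a
  refine (abs_add_le _ _).trans ?_
  rw [abs_mul a, abs_mul c, abs_of_nonneg ha0, abs_of_nonneg hc]
  have hn : 0 ≤ ‖x - y‖ ^ β := by positivity
  calc _ ≤ a * (L * (s ^ β * ‖x - y‖ ^ β)) + c * (L * (2 ^ β * ‖x - y‖ ^ β)) := by gcongr
    _ = c * (2 * 2 ^ β * L) * ‖x - y‖ ^ β := by linear_combination (L * ‖x - y‖ ^ β) * has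
    _ ≤ c * (2 * 2 ^ β * (L + 1)) * ‖x - y‖ ^ β := by gcongr; linarith
    _ ≤ K * ‖x - y‖ ^ β := by gcongr; exact (le_div_iff₀ hT).1 hcc

/-! ### Dyadic cells -/

/-- The closed dyadic cube of side `2^{-m}` with index `i`. -/
def closedCell (m : ℕ) (i : Fin d → Fin (2 ^ m)) : Set (Cube d) :=
  {x | ∀ j, ((i j : ℕ) : ℝ) / 2 ^ m ≤ x.1 j ∧ x.1 j ≤ (((i j : ℕ) : ℝ) + 1) / 2 ^ m}

lemma cell_subset_closedCell (m : ℕ) (i : Fin d → Fin (2 ^ m)) : cell m i ⊆ closedCell m i :=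
  fun _ hx j => ⟨(hx j).1.le, (hx j).2.le⟩

lemma isOpen_cell (m : ℕ) (i : Fin d → Fin (2 ^ m)) : IsOpen (cell m i) := by
  have : cell m i = ⋂ j, {x : Cube d | ((i j : ℕ) : ℝ) / 2 ^ m < x.1 j ∧
      x.1 j < (((i j : ℕ) : ℝ) + 1) / 2 ^ m} := by
    ext x
    simp [cell]
  rw [this]
  refine isOpen_iInter_of_finite fun j => ?_
  have hc : Continuous fun x : Cube d => x.1 j := (continuous_apply j).comp continuous_subtype_val
  exact (isOpen_lt continuous_const hc).inter (isOpen_lt hc continuous_const)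

lemma isClosed_closedCell (m : ℕ) (i : Fin d → Fin (2 ^ m)) : IsClosed (closedCell m i) := by
  have : closedCell m i = ⋂ j, {x : Cube d | ((i j : ℕ) : ℝ) / 2 ^ m ≤ x.1 j ∧
      x.1 j ≤ (((i j : ℕ) : ℝ) + 1) / 2 ^ m} := by
    ext x
    simp [closedCell]
  rw [this]
  refine isClosed_iInter fun j => ?_
  have hc : Continuous fun x : Cube d => x.1 j := (continuous_apply j).comp continuous_subtype_val
  exact (isClosed_le continuous_const hc).inter (isClosed_le hc continuous_const)

lemma measurableSet_cell (m : ℕ) (i : Fin d → Fin (2 ^ m)) : MeasurableSet (cell m i) :=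
  (isOpen_cell m i).measurableSet

lemma div_two_pow_lt_iff (m P a b : ℕ) :
    (a : ℝ) / 2 ^ m < (b : ℝ) / 2 ^ (m + P) ↔ a * 2 ^ P < b := by
  rw [div_lt_div_iff₀ (by positivity) (by positivity), pow_add]
  have : (a : ℝ) * (2 ^ m * 2 ^ P) < b * 2 ^ m ↔ (a : ℝ) * 2 ^ P < b := by
    rw [show (a : ℝ) * (2 ^ m * 2 ^ P) = a * 2 ^ P * 2 ^ m by ring]
    exact mul_lt_mul_iff_left₀ (by positivity)
  rw [this]
  exact_mod_cast Iff.rfl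

lemma lt_div_two_pow_iff (m P a b : ℕ) :
    (b : ℝ) / 2 ^ (m + P) < (a : ℝ) / 2 ^ m ↔ b < a * 2 ^ P := by
  rw [div_lt_div_iff₀ (by positivity) (by positivity), pow_add]
  have : (b : ℝ) * 2 ^ m < a * (2 ^ m * 2 ^ P) ↔ (b : ℝ) < a * 2 ^ P := by
    rw [show (a : ℝ) * (2 ^ m * 2 ^ P) = a * 2 ^ P * 2 ^ m by ring]
    exact mul_lt_mul_iff_left₀ (by positivity)
  rw [this]
  exact_mod_cast Iff.rfl

/-- A dyadic interval and a finer one are nested, unless one lies to the left of the other. -/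
lemma dyadic_nested {m P a b : ℕ} (h1 : (a : ℝ) / 2 ^ m < ((b : ℝ) + 1) / 2 ^ (m + P))
    (h2 : (b : ℝ) / 2 ^ (m + P) < ((a : ℝ) + 1) / 2 ^ m) :
    (a : ℝ) / 2 ^ m ≤ (b : ℝ) / 2 ^ (m + P) ∧
      ((b : ℝ) + 1) / 2 ^ (m + P) ≤ ((a : ℝ) + 1) / 2 ^ m := by
  have e1 := (div_two_pow_lt_iff m P a (b + 1)).1 (by push_cast; exact h1)
  have e2 := (lt_div_two_pow_iff m P (a + 1) b).1 (by push_cast; exact h2)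
  constructor
  · by_contra! h
    have := (lt_div_two_pow_iff m P a b).1 h
    omega
  · by_contra! h
    have := (div_two_pow_lt_iff m P (a + 1) (b + 1)).1 (by push_cast; exact h)
    omega

lemma cell_subset_cell_of_le {m M : ℕ} (h : m ≤ M) {i : Fin d → Fin (2 ^ m)}
    {k : Fin d → Fin (2 ^ M)} {x : Cube d} (hx : x ∈ cell m i) (hx' : x ∈ closedCell M k) :
    cell M k ⊆ cell m i := by
  obtain ⟨P, rfl⟩ := Nat.exists_eq_add_of_le h
  intro y hy j
  have := dyadic_nested ((hx j).1.trans_le (hx' j).2) ((hx' j).1.trans_lt (hx j).2)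
  exact ⟨this.1.trans_lt (hy j).1, (hy j).2.trans_le this.2⟩

lemma cell_subset_cell_of_ge {m M : ℕ} (h : M ≤ m) {i : Fin d → Fin (2 ^ m)}
    {k : Fin d → Fin (2 ^ M)} {x : Cube d} (hx : x ∈ cell m i) (hx' : x ∈ closedCell M k) :
    cell m i ⊆ cell M k := by
  obtain ⟨P, rfl⟩ := Nat.exists_eq_add_of_le h
  intro y hy j
  have := dyadic_nested ((hx' j).1.trans_lt (hx j).2) ((hx j).1.trans_le (hx' j).2)
  exact ⟨this.1.trans_lt (hy j).1, (hy j).2.trans_le this.2⟩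

lemma eq_of_mem_cell {m : ℕ} {i i' : Fin d → Fin (2 ^ m)} {x : Cube d} (hx : x ∈ cell m i)
    (hx' : x ∈ cell m i') : i = i' := by
  ext j
  have e1 := (div_two_pow_lt_iff m 0 (i j) (i' j + 1)).1
    (by push_cast; exact (hx j).1.trans (hx' j).2)
  have e2 := (div_two_pow_lt_iff m 0 (i' j) (i j + 1)).1
    (by push_cast; exact (hx' j).1.trans (hx j).2)
  omega

lemma cell_nonempty (m : ℕ) (i : Fin d → Fin (2 ^ m)) : (cell m i).Nonempty := by
  have h2 : (0 : ℝ) < 2 ^ m := by positivity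
  have hi (j : Fin d) : ((i j : ℕ) : ℝ) + 1 ≤ 2 ^ m := by exact_mod_cast (i j).2
  refine ⟨⟨fun j => (((i j : ℕ) : ℝ) + 1 / 2) / 2 ^ m, fun j => ?_, fun j => ?_⟩, fun j => ⟨?_, ?_⟩⟩
  · simp only [Pi.zero_apply]
    positivity
  · simp only [Pi.one_apply]
    rw [div_le_one h2]
    linarith [hi j]
  · change _ < _ / _
    gcongr
    linarith
  · change _ / _ < _
    gcongr
    linarith

/-! ### Lebesgue measure of the cells -/

/-- Lebesgue measure on the unit cube. -/
def cubeVolume (d : ℕ) : Measure (Cube d) :=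
  (volume : Measure (Fin d → ℝ)).comap ((↑) : Cube d → Fin d → ℝ)

lemma cubeVolume_cell (m : ℕ) (i : Fin d → Fin (2 ^ m)) :
    cubeVolume d (cell m i) = ENNReal.ofReal (((2 : ℝ) ^ (d * m))⁻¹) := by
  have h2 : (0 : ℝ) < 2 ^ m := by positivity
  have himg : ((↑) : Cube d → Fin d → ℝ) '' cell m i =
      Set.pi univ fun j => Ioo (((i j : ℕ) : ℝ) / 2 ^ m) ((((i j : ℕ) : ℝ) + 1) / 2 ^ m) := by
    ext x
    constructor
    · rintro ⟨y, hy, rfl⟩ j -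
      exact hy j
    · intro hx
      refine ⟨⟨x, fun j => ?_, fun j => ?_⟩, fun j => hx j (mem_univ j), rfl⟩
      · exact (div_nonneg (Nat.cast_nonneg _) h2.le).trans (hx j (mem_univ j)).1.le
      · refine (hx j (mem_univ j)).2.le.trans ?_
        rw [Pi.one_apply, div_le_one h2]
        exact_mod_cast (i j).2
  rw [cubeVolume, comap_subtype_coe_apply measurableSet_Icc, himg, Real.volume_pi_Ioo]
  have (j : Fin d) : (((i j : ℕ) : ℝ) + 1) / 2 ^ m - ((i j : ℕ) : ℝ) / 2 ^ m = (2 ^ m)⁻¹ := by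
    field_simp
    ring
  simp only [this]
  rw [Finset.prod_const, Finset.card_univ, Fintype.card_fin, ← ENNReal.ofReal_pow (by positivity),
    inv_pow, ← pow_mul, mul_comm m d]

instance isProbabilityMeasure_cubeVolume : IsProbabilityMeasure (cubeVolume d) := by
  constructor
  rw [cubeVolume, comap_subtype_coe_apply measurableSet_Icc, image_univ, Subtype.range_coe,
    Real.volume_Icc_pi]
  simp

/-- The grid hyperplanes are null sets, because the open cells exhaust the volume of the cube. -/
lemma ae_cubeVolume_exists_mem_cell (m : ℕ) :
    ∀ᵐ x ∂cubeVolume d, ∃ i : Fin d → Fin (2 ^ m), x ∈ cell m i := by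
  have hU : cubeVolume d (⋃ i : Fin d → Fin (2 ^ m), (cell m i : Set (Cube d))) = 1 := by
    rw [measure_iUnion (fun i i' hii => disjoint_left.2 fun x hx hx' => hii (eq_of_mem_cell hx hx'))
      (fun i => measurableSet_cell m i)]
    simp only [cubeVolume_cell]
    rw [tsum_fintype, Finset.sum_const, Finset.card_univ, Fintype.card_fun, Fintype.card_fin,
      Fintype.card_fin, nsmul_eq_mul, ← pow_mul, mul_comm m d, ENNReal.ofReal_inv_of_pos
      (by positivity), ENNReal.ofReal_pow (by norm_num)]
    push_cast
    rw [ENNReal.ofReal_ofNat]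
    exact ENNReal.mul_inv_cancel (by simp) (by simp)
  have hm : MeasurableSet (⋃ i : Fin d → Fin (2 ^ m), (cell m i : Set (Cube d))) :=
    MeasurableSet.iUnion fun i => measurableSet_cell m i
  have := (prob_compl_eq_zero_iff hm).2 hU
  rw [ae_iff]
  convert this using 2
  ext x
  simp

/-- The uniform distribution on a dyadic cell. -/
def cellUniform (m : ℕ) (i : Fin d → Fin (2 ^ m)) : Measure (Cube d) := (cubeVolume d)[|cell m i]

lemma cubeVolume_cell_ne_zero (m : ℕ) (i : Fin d → Fin (2 ^ m)) : cubeVolume d (cell m i) ≠ 0 := by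
  rw [cubeVolume_cell]
  exact (ENNReal.ofReal_pos.2 (by positivity)).ne'

instance (m : ℕ) (i : Fin d → Fin (2 ^ m)) : IsProbabilityMeasure (cellUniform m i) :=
  cond_isProbabilityMeasure (cubeVolume_cell_ne_zero m i)

lemma ae_cellUniform_mem (m : ℕ) (i : Fin d → Fin (2 ^ m)) : ∀ᵐ x ∂cellUniform m i, x ∈ cell m i :=
  ae_cond_mem (measurableSet_cell m i)

lemma cellUniform_real_of_subset {m M : ℕ} {i : Fin d → Fin (2 ^ m)} {k : Fin d → Fin (2 ^ M)}
    (h : cell m i ⊆ cell M k) :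
    (cellUniform M k).real (cell m i) = 2 ^ (d * M) * ((2 : ℝ) ^ (d * m))⁻¹ := by
  rw [measureReal_def, cellUniform, cond_apply (measurableSet_cell M k),
    inter_eq_self_of_subset_right h, cubeVolume_cell, cubeVolume_cell, ENNReal.toReal_mul,
    ENNReal.toReal_inv, ENNReal.toReal_ofReal (by positivity),
    ENNReal.toReal_ofReal (by positivity), inv_inv]

lemma cellUniform_real_eq_one {M : ℕ} {k : Fin d → Fin (2 ^ M)} {S : Set (Cube d)}
    (h : cell M k ⊆ S) : (cellUniform M k).real S = 1 := by
  rw [measureReal_def, cellUniform, cond_apply (measurableSet_cell M k),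
    inter_eq_self_of_subset_left h, ENNReal.inv_mul_cancel (cubeVolume_cell_ne_zero M k)
    (measure_ne_top _ _), ENNReal.toReal_one]

/-! ### Mixtures of uniform distributions on cells -/

/-- The mixture of the uniform distributions on the cells `κ k` of level `M`, with weights `p k`. -/
def cellMixture {ι : Type*} [Fintype ι] {M : ℕ} (p : ι → ℝ) (κ : ι → Fin d → Fin (2 ^ M)) :
    Measure (Cube d) :=
  ∑ k, ENNReal.ofReal (p k) • cellUniform M (κ k)

section CellMixture

variable {ι : Type*} [Fintype ι] {M : ℕ} {p : ι → ℝ} {κ : ι → Fin d → Fin (2 ^ M)}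

lemma cellMixture_apply (S : Set (Cube d)) :
    cellMixture p κ S = ∑ k, ENNReal.ofReal (p k) * cellUniform M (κ k) S := by
  simp [cellMixture, Measure.finsetSum_apply]

lemma cellMixture_real (hp : ∀ k, 0 ≤ p k) (S : Set (Cube d)) :
    (cellMixture p κ).real S = ∑ k, p k * (cellUniform M (κ k)).real S := by
  rw [measureReal_def, cellMixture_apply, ENNReal.toReal_sum fun k _ =>
    ENNReal.mul_ne_top ENNReal.ofReal_ne_top (measure_ne_top _ _)]
  refine Finset.sum_congr rfl fun k _ => ?_
  rw [ENNReal.toReal_mul, ENNReal.toReal_ofReal (hp k), measureReal_def]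

lemma isProbabilityMeasure_cellMixture (hp : ∀ k, 0 ≤ p k) (hs : ∑ k, p k = 1) :
    IsProbabilityMeasure (cellMixture p κ) := by
  constructor
  rw [cellMixture_apply]
  simp only [measure_univ, mul_one]
  rw [← ENNReal.ofReal_sum_of_nonneg fun k _ => hp k, hs, ENNReal.ofReal_one]

lemma integral_cellMixture (hp : ∀ k, 0 ≤ p k) {f : Cube d → ℝ}
    (hf : ∀ k, Integrable f (cellUniform M (κ k))) :
    ∫ x, f x ∂cellMixture p κ = ∑ k, p k * ∫ x, f x ∂cellUniform M (κ k) := by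
  rw [cellMixture, integral_finsetSum_measure fun k _ => (hf k).smul_measure ENNReal.ofReal_ne_top]
  refine Finset.sum_congr rfl fun k _ => ?_
  rw [integral_smul_measure, ENNReal.toReal_ofReal (hp k), smul_eq_mul]

lemma ae_cellMixture {Q : Cube d → Prop} (h : ∀ k, ∀ᵐ x ∂cellUniform M (κ k), Q x) :
    ∀ᵐ x ∂cellMixture p κ, Q x := by
  rw [ae_iff, cellMixture_apply]
  exact Finset.sum_eq_zero fun k _ => by rw [ae_iff.1 (h k), mul_zero]

lemma ae_cellMixture_exists_mem_cell (m : ℕ) :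
    ∀ᵐ x ∂cellMixture p κ, ∃ i : Fin d → Fin (2 ^ m), x ∈ cell m i :=
  ae_cellMixture fun _ => cond_absolutelyContinuous.ae_le (ae_cubeVolume_exists_mem_cell m)

/-- The support consists of the closures of the cells that are charged. -/
lemma exists_mem_closedCell_of_mem_support {x : Cube d} (hx : x ∈ (cellMixture p κ).support) :
    ∃ k, x ∈ closedCell M (κ k) := by
  have hcl : IsClosed (⋃ k, closedCell M (κ k)) :=
    isClosed_iUnion_of_finite fun k => isClosed_closedCell M (κ k)
  have := Measure.support_subset_of_isClosed hcl (μ := cellMixture p κ)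
    (ae_cellMixture fun k => (ae_cellUniform_mem M (κ k)).mono fun y hy =>
      mem_iUnion.2 ⟨k, cell_subset_closedCell _ _ hy⟩)
  exact mem_iUnion.1 (this hx)

lemma le_cellMixture_real (hp : ∀ k, 0 ≤ p k) (S : Set (Cube d)) (k : ι) :
    p k * (cellUniform M (κ k)).real S ≤ (cellMixture p κ).real S := by
  rw [cellMixture_real hp]
  exact Finset.single_le_sum (f := fun k => p k * (cellUniform M (κ k)).real S)
    (fun k _ => mul_nonneg (hp k) measureReal_nonneg) (Finset.mem_univ k)

/-- Mixtures are regular, with constants that depend on the mixture: at levels up to `M` all charged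
cells have mass between `min p` and one, and at finer levels the density of the mixture matters,
which is constant on each cell of level `M`. -/
lemma isRegular_cellMixture [Nonempty ι] (hp : ∀ k, 0 < p k) (hs : ∑ k, p k = 1) :
    ∃ u₁ u₂ : ℝ, IsRegular (cellMixture p κ) u₁ u₂ := by
  obtain ⟨k₀, hk₀⟩ := Finite.exists_min p
  have hp' (k : ι) : 0 ≤ p k := (hp k).le
  have hpr := isProbabilityMeasure_cellMixture (κ := κ) hp' hs
  have h1 : p k₀ ≤ 1 := hs ▸ Finset.single_le_sum (fun k _ => hp' k) (Finset.mem_univ k₀)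
  have h2 : (1 : ℝ) ≤ 2 ^ (d * M) := one_le_pow₀ (by norm_num)
  refine ⟨p k₀, 2 ^ (d * M), hp k₀, h1.trans h2, fun m _ =>
    ⟨ae_cellMixture_exists_mem_cell m, ?_⟩⟩
  rintro i ⟨x, hxi, hx⟩
  obtain ⟨k, hk⟩ := exists_mem_closedCell_of_mem_support hx
  have hm0 : (0 : ℝ) < (2 ^ (d * m))⁻¹ := by positivity
  have hle := le_cellMixture_real (κ := κ) hp' (cell m i) k
  rcases le_total m M with hmM | hmM
  · have hinv : ((2 : ℝ) ^ (d * m))⁻¹ ≤ 1 := inv_le_one_of_one_le₀ (one_le_pow₀ (by norm_num))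
    constructor
    · rw [cellUniform_real_eq_one (cell_subset_cell_of_le hmM hxi hk), mul_one] at hle
      calc _ ≤ p k₀ * 1 := by gcongr; exact hp' _
        _ ≤ p k := by rw [mul_one]; exact hk₀ k
        _ ≤ _ := hle
    · refine measureReal_le_one.trans ?_
      rw [← div_eq_mul_inv, one_le_div (by positivity)]
      exact pow_le_pow_right₀ (by norm_num) (Nat.mul_le_mul_left d hmM)
  · constructor
    · rw [cellUniform_real_of_subset (cell_subset_cell_of_ge hmM hxi hk)] at hle
      refine le_trans ?_ hle
      rw [← mul_assoc]
      gcongr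
      calc p k₀ ≤ p k * 1 := by rw [mul_one]; exact hk₀ k
        _ ≤ _ := by gcongr; exact hp' k
    · have hk' (k' : ι) : (cellUniform M (κ k')).real (cell m i) ≤
          2 ^ (d * M) * ((2 : ℝ) ^ (d * m))⁻¹ := by
        by_cases hne : (cell m i ∩ cell M (κ k')).Nonempty
        · obtain ⟨y, hy, hy'⟩ := hne
          exact (cellUniform_real_of_subset
            (cell_subset_cell_of_ge hmM hy (cell_subset_closedCell _ _ hy'))).le
        · rw [measureReal_def, cellUniform, cond_apply (measurableSet_cell M _), inter_comm,
            not_nonempty_iff_eq_empty.1 hne]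
          simp only [measure_empty, mul_zero, ENNReal.toReal_zero]
          positivity
      rw [cellMixture_real hp']
      calc _ ≤ ∑ k', p k' * (2 ^ (d * M) * ((2 : ℝ) ^ (d * m))⁻¹) :=
            Finset.sum_le_sum fun k' _ => mul_le_mul_of_nonneg_left (hk' k') (hp' k')
        _ = _ := by rw [← Finset.sum_mul, hs, one_mul]

end CellMixture

/-! ### Models with a piecewise constant regression function on the support -/

/-- The marginal of `P` is the mixture with weights `p k` of the uniform distributions on the cells
`κ k` of level `M`, and the regression function has the constant value `v k` on the closed cell. -/
structure IsCellModel {ι : Type*} [Fintype ι] {M : ℕ} (P : Model d) (p : ι → ℝ)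
    (κ : ι → Fin d → Fin (2 ^ M)) (v : ι → ℝ) : Prop where
  pos : ∀ k, 0 < p k
  sum_eq_one : ∑ k, p k = 1
  marginal_eq : P.marginal = cellMixture p κ
  eta_eq : ∀ k, ∀ x ∈ closedCell M (κ k), P.eta x = v k

lemma piecewiseConst_eq {m : ℕ} (c : (Fin d → Fin (2 ^ m)) → ℝ) {i : Fin d → Fin (2 ^ m)}
    {x : Cube d} (hx : x ∈ cell m i) : piecewiseConst m c x = c i := by
  unfold piecewiseConst
  rw [Finset.sum_eq_single i (fun i' _ hi' => indicator_of_notMem (fun hx' =>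
    hi' (eq_of_mem_cell hx' hx)) _) (by simp), indicator_of_mem hx]

lemma measurable_piecewiseConst {m : ℕ} (c : (Fin d → Fin (2 ^ m)) → ℝ) :
    Measurable (piecewiseConst m c) := by
  unfold piecewiseConst
  exact Finset.measurable_sum _ fun i _ => measurable_const.indicator (measurableSet_cell m i)

lemma abs_piecewiseConst_le {m : ℕ} {c : (Fin d → Fin (2 ^ m)) → ℝ} (hc : ∀ i, |c i| ≤ 1)
    (x : Cube d) : |piecewiseConst m c x| ≤ 1 := by
  by_cases h : ∃ i : Fin d → Fin (2 ^ m), x ∈ cell m i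
  · obtain ⟨i, hi⟩ := h
    rw [piecewiseConst_eq c hi]
    exact hc i
  · unfold piecewiseConst
    rw [Finset.sum_eq_zero fun i _ => indicator_of_notMem (not_exists.1 h i) _, abs_zero]
    exact zero_le_one

lemma Model.measurable_eta_coe (P : Model d) : Measurable fun x : Cube d => P.eta x :=
  P.measurable_eta.comp measurable_subtype_coe

lemma Model.integrable_sq_sub (P : Model d) {m : ℕ} {h : Cube d → ℝ} (hh : h ∈ pcClass d m)
    (μ : Measure (Cube d)) [IsFiniteMeasure μ] :
    Integrable (fun x : Cube d => (P.eta x - h x) ^ 2) μ := by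
  obtain ⟨c, hc, rfl⟩ := hh
  refine Integrable.of_bound ((P.measurable_eta_coe.sub
    (measurable_piecewiseConst c)).pow_const 2).aestronglyMeasurable (2 ^ 2)
    (Filter.Eventually.of_forall fun x => ?_)
  rw [norm_pow]
  gcongr
  refine (norm_sub_le _ _).trans ?_
  have h1 := P.abs_eta_le_one x
  have h2 := abs_piecewiseConst_le hc x
  simp only [Real.norm_eq_abs]
  linarith

section IsCellModel

variable {ι : Type*} [Fintype ι] {M : ℕ} {P : Model d} {p : ι → ℝ}
  {κ : ι → Fin d → Fin (2 ^ M)} {v : ι → ℝ}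

lemma IsCellModel.lowNoise (h : IsCellModel P p κ v) {γ B : ℝ}
    (hB : ∀ t : ℝ, 0 < t → ∑ k with |v k| ≤ t, p k ≤ B * t ^ γ) : P.LowNoise γ B := by
  intro t ht
  refine le_trans ?_ (hB t ht)
  rw [h.marginal_eq, cellMixture_real fun k => (h.pos k).le, Finset.sum_filter]
  refine Finset.sum_le_sum fun k _ => ?_
  split_ifs with hk
  · exact mul_le_of_le_one_right (h.pos k).le measureReal_le_one
  · refine (mul_eq_zero_of_right _ ?_).le
    rw [measureReal_def, measure_eq_zero_iff_ae_notMem.2, ENNReal.toReal_zero]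
    filter_upwards [ae_cellUniform_mem M (κ k)] with x hx hx'
    have hx'' : |P.eta x| ≤ t := hx'
    rw [h.eta_eq k x (cell_subset_closedCell _ _ hx)] at hx''
    exact hk hx''

/-- At levels finer than `M`, the regression function is constant on a cell that meets the
support. -/
lemma IsCellModel.eta_eq_of_mem (h : IsCellModel P p κ v) {m : ℕ} (hm : M ≤ m)
    {i : Fin d → Fin (2 ^ m)} {x y : Cube d} (hx : x ∈ P.marginal.support) (hxi : x ∈ cell m i)
    (hyi : y ∈ cell m i) : P.eta y = P.eta x := by
  rw [h.marginal_eq] at hx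
  obtain ⟨k, hk⟩ := exists_mem_closedCell_of_mem_support hx
  rw [h.eta_eq k x hk, h.eta_eq k y
    (cell_subset_closedCell _ _ (cell_subset_cell_of_ge hm hxi hk hyi))]

/-- At levels finer than `M`, the projection agrees with the regression function on the support. -/
lemma IsCellModel.eta_eq_projection (h : IsCellModel P p κ v) {m : ℕ} (hm : M ≤ m)
    {f : Cube d → ℝ} (hf : P.IsProjection m f) {i : Fin d → Fin (2 ^ m)} {x : Cube d}
    (hx : x ∈ P.marginal.support) (hxi : x ∈ cell m i) : P.eta x = f x := by
  have hpr : IsProbabilityMeasure P.marginal := P.isProbabilityMeasure_marginal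
  set c' : (Fin d → Fin (2 ^ m)) → ℝ := fun i => P.eta (cell_nonempty m i).some with hc'
  have hg : piecewiseConst m c' ∈ pcClass d m := ⟨c', fun i => P.abs_eta_le_one _, rfl⟩
  have hae : ∀ᵐ y : Cube d ∂P.marginal, P.eta y = piecewiseConst m c' y := by
    have h1 : ∀ᵐ y ∂P.marginal, ∃ i : Fin d → Fin (2 ^ m), y ∈ cell m i := by
      rw [h.marginal_eq]
      exact ae_cellMixture_exists_mem_cell m
    filter_upwards [h1, Measure.support_mem_ae (μ := P.marginal)] with y hy hys
    obtain ⟨j, hj⟩ := hy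
    rw [piecewiseConst_eq c' hj]
    exact (h.eta_eq_of_mem hm hys hj (cell_nonempty m j).some_mem).symm
  have h0 : ∫ y, (P.eta y - piecewiseConst m c' y) ^ 2 ∂P.marginal = 0 := by
    rw [integral_congr_ae (g := fun _ => (0 : ℝ)) (hae.mono fun y hy => by simp [hy])]
    exact integral_zero _ _
  have h1 : ∫ y, (P.eta y - f y) ^ 2 ∂P.marginal = 0 :=
    le_antisymm (h0 ▸ hf.2 _ hg) (integral_nonneg fun y => sq_nonneg _)
  rw [integral_eq_zero_iff_of_nonneg (fun y => sq_nonneg _)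
    (P.integrable_sq_sub hf.1 _)] at h1
  have hpos : 0 < P.marginal (cell m i) :=
    (Measure.mem_support_iff_forall x).1 hx _ ((isOpen_cell m i).mem_nhds hxi)
  obtain ⟨y, hy, hyi⟩ := (h1.and_frequently
    (frequently_ae_mem_iff.2 hpos.ne')).exists
  obtain ⟨c, -, rfl⟩ := hf.1
  rw [← h.eta_eq_of_mem hm hx hxi hyi, piecewiseConst_eq c hxi]
  have hy' : (P.eta y - piecewiseConst m c y) ^ 2 = 0 := hy
  rw [piecewiseConst_eq c hyi] at hy'
  exact sub_eq_zero.1 (pow_eq_zero_iff two_ne_zero |>.1 hy')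

/-- At levels up to `M`, the error of any function of `pcClass d m` is constant on each cell of
level `M`, so that its value at a point of the support is seen by its conditional `L₂`-norm. -/
lemma IsCellModel.le_integral_cond (h : IsCellModel P p κ v) {p₀ : ℝ} (hp₀ : ∀ k, p₀ ≤ p k) {m : ℕ}
    (hm : m ≤ M) {f : Cube d → ℝ} (hf : f ∈ pcClass d m) {I : Set (Fin d → Fin (2 ^ m))}
    {x : Cube d} (hx : x ∈ cellUnion m I ∩ P.marginal.support) :
    p₀ * (P.eta x - f x) ^ 2 ≤
      ∫ y, (P.eta y - f y) ^ 2 ∂(P.marginal[|cellUnion m I ∩ P.marginal.support]) := by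
  have hpr : IsProbabilityMeasure P.marginal := P.isProbabilityMeasure_marginal
  have hint := P.integrable_sq_sub hf P.marginal
  obtain ⟨hxI, hxs⟩ := hx
  obtain ⟨i, hiI, hxi⟩ := mem_iUnion₂.1 hxI
  have hxs' := hxs
  rw [h.marginal_eq] at hxs'
  obtain ⟨k, hk⟩ := exists_mem_closedCell_of_mem_support hxs'
  have hsub := cell_subset_cell_of_le hm hxi hk
  set A := cellUnion m I with hA
  have hAm : MeasurableSet A :=
    MeasurableSet.biUnion (to_countable _) fun j _ => measurableSet_cell m j
  have hsubA : cell M (κ k) ⊆ A := fun y hy => mem_biUnion hiI (hsub hy)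
  have hAe : (A ∩ P.marginal.support : Set (Cube d)) =ᵐ[P.marginal] A :=
    inter_ae_eq_left_of_ae_eq_univ (Filter.eventuallyEq_univ.2 Measure.support_mem_ae)
  have hcell : p k ≤ P.marginal.real (cell M (κ k)) := by
    rw [h.marginal_eq]
    have := le_cellMixture_real (κ := κ) (fun k => (h.pos k).le) (cell M (κ k)) k
    rwa [cellUniform_real_eq_one subset_rfl, mul_one] at this
  have h1 : p₀ * (P.eta x - f x) ^ 2 ≤ ∫ y in A, (P.eta y - f y) ^ 2 ∂P.marginal := by
    calc p₀ * (P.eta x - f x) ^ 2 ≤ P.marginal.real (cell M (κ k)) * (P.eta x - f x) ^ 2 := by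
          gcongr
          exact (hp₀ k).trans hcell
      _ = ∫ y in cell M (κ k), (P.eta x - f x) ^ 2 ∂P.marginal := by
          rw [setIntegral_const, smul_eq_mul]
      _ = ∫ y in cell M (κ k), (P.eta y - f y) ^ 2 ∂P.marginal := by
          obtain ⟨c, -, rfl⟩ := hf
          refine setIntegral_congr_fun (measurableSet_cell M _) fun y hy => ?_
          rw [h.eta_eq k x hk, h.eta_eq k y (cell_subset_closedCell _ _ hy),
            piecewiseConst_eq c hxi, piecewiseConst_eq c (hsub hy)]
      _ ≤ _ := setIntegral_mono_set hint.integrableOn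
          (Filter.Eventually.of_forall fun y => sq_nonneg _) hsubA.eventuallyLE
  have h2 : 0 ≤ ∫ y in A, (P.eta y - f y) ^ 2 ∂P.marginal :=
    integral_nonneg fun y => sq_nonneg _
  have hA0 : P.marginal A ≠ 0 := by
    have : 0 < P.marginal.real A :=
      ((h.pos k).trans_le hcell).trans_le (measureReal_mono hsubA)
    intro h0
    rw [measureReal_def, h0] at this
    simp at this
  rw [ProbabilityTheory.cond, Measure.restrict_congr_set hAe, measure_congr hAe,
    integral_smul_measure, smul_eq_mul]
  refine h1.trans (le_mul_of_one_le_left h2 ?_)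
  rw [ENNReal.toReal_inv]
  refine (one_le_inv₀ (ENNReal.toReal_pos hA0 (measure_ne_top _ _))).2 ?_
  exact measureReal_le_one

lemma IsCellModel.supNormControl [Nonempty ι] (h : IsCellModel P p κ v) :
    ∃ B₂ : ℝ, 0 < B₂ ∧ P.SupNormControl B₂ := by
  obtain ⟨k₀, hk₀⟩ := Finite.exists_min p
  refine ⟨p k₀, h.pos k₀, fun m _ I _ hne f hf => ?_⟩
  set R := ∫ y, (P.eta y - f y) ^ 2 ∂(P.marginal[|cellUnion m I ∩ P.marginal.support])
  have hR : 0 ≤ R := integral_nonneg fun y => sq_nonneg _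
  have hpt (x : Cube d) (hx : x ∈ cellUnion m I ∩ P.marginal.support) :
      p k₀ * (P.eta x - f x) ^ 2 ≤ R := by
    rcases le_total m M with hm | hm
    · exact h.le_integral_cond hk₀ hm hf.1 hx
    · obtain ⟨i, -, hxi⟩ := mem_iUnion₂.1 hx.1
      rw [h.eta_eq_projection hm hf hx.2 hxi]
      simpa using hR
  have : Nonempty ↥(cellUnion m I ∩ P.marginal.support) := hne.to_subtype
  have hp0 := h.pos k₀
  have hsup : supNormOn (fun x => P.eta x - f x) (cellUnion m I ∩ P.marginal.support) ≤
      √(R / p k₀) := by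
    refine ciSup_le fun x => Real.abs_le_sqrt ?_
    rw [le_div_iff₀ hp0, mul_comm]
    exact hpt x.1 x.2
  have hsup0 : 0 ≤ supNormOn (fun x => P.eta x - f x) (cellUnion m I ∩ P.marginal.support) :=
    Real.iSup_nonneg fun x => abs_nonneg _
  calc _ ≤ p k₀ * √(R / p k₀) ^ 2 := by gcongr
    _ = R := by rw [Real.sq_sqrt (by positivity), mul_div_cancel₀ _ hp0.ne']

lemma IsCellModel.mem_classPUStar [Nonempty ι] (h : IsCellModel P p κ v) {β γ B K : ℝ}
    (hK : IsHolderClass β K P.eta)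
    (hB : ∀ t : ℝ, 0 < t → ∑ k with |v k| ≤ t, p k ≤ B * t ^ γ) :
    P ∈ classPUStar d β γ B K :=
  ⟨⟨⟨h.lowNoise hB, hK⟩, h.marginal_eq ▸ isRegular_cellMixture h.pos h.sum_eq_one⟩,
    h.supNormControl⟩

end IsCellModel

/-! ### The law of the data -/

/-- The conditional probability of the label `b` at the point `x`. -/
def Model.labelProb (P : Model d) (z : Cube d × Bool) : ℝ :=
  if z.2 then (1 + P.eta z.1) / 2 else (1 - P.eta z.1) / 2

lemma Model.measurable_labelProb (P : Model d) : Measurable P.labelProb := by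
  have h : Measurable fun z : Cube d × Bool => P.eta z.1 := P.measurable_eta_coe.comp measurable_fst
  exact Measurable.ite (measurable_snd (measurableSet_singleton true))
    ((h.const_add 1).div_const 2) ((h.const_sub 1).div_const 2)

lemma Model.labelProb_nonneg (P : Model d) (z : Cube d × Bool) : 0 ≤ P.labelProb z := by
  have h := abs_le.1 (P.abs_eta_le_one z.1)
  unfold labelProb
  split_ifs <;> linarith

lemma Model.labelProb_add (P : Model d) (x : Cube d) :
    P.labelProb (x, true) + P.labelProb (x, false) = 1 := by
  simp only [labelProb, if_true, Bool.false_eq_true, if_false]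
  ring

lemma Model.labelProb_le_one (P : Model d) (z : Cube d × Bool) : P.labelProb z ≤ 1 := by
  have h := abs_le.1 (P.abs_eta_le_one z.1)
  unfold labelProb
  split_ifs <;> linarith

lemma Model.label_apply (P : Model d) (x : Cube d) :
    P.label x = ENNReal.ofReal (P.labelProb (x, true)) • Measure.dirac true +
      ENNReal.ofReal (P.labelProb (x, false)) • Measure.dirac false := by
  simp only [labelProb, if_true, Bool.false_eq_true, if_false]
  rfl

lemma Model.integral_label (P : Model d) (x : Cube d) (f : Bool → ℝ) :
    ∫ y, f y ∂P.label x =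
      P.labelProb (x, true) * f true + P.labelProb (x, false) * f false := by
  rw [P.label_apply, integral_add_measure, integral_smul_measure, integral_smul_measure,
    integral_dirac, integral_dirac, ENNReal.toReal_ofReal (P.labelProb_nonneg _),
    ENNReal.toReal_ofReal (P.labelProb_nonneg _), smul_eq_mul, smul_eq_mul]
  · exact (integrable_dirac (by simp)).smul_measure ENNReal.ofReal_ne_top
  · exact (integrable_dirac (by simp)).smul_measure ENNReal.ofReal_ne_top

section DataLaw

variable {N : ℕ} (A : ActiveClassifier d N)

instance (k : ℕ) : IsMarkovKernel (A.query k) := A.isMarkovKernel_query k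

lemma measurable_snoc (k : ℕ) : Measurable fun w : (Fin k → Cube d × Bool) × (Cube d × Bool) =>
    (Fin.snoc (α := fun _ => Cube d × Bool) w.1 w.2 : Fin (k + 1) → Cube d × Bool) := by
  refine measurable_pi_iff.2 fun j => ?_
  induction j using Fin.lastCases with
  | last => simpa using measurable_snd
  | cast j =>
    simp only [Fin.snoc_castSucc]
    exact (measurable_pi_apply j).comp measurable_fst

instance isProbabilityMeasure_dataLaw (P : Model d) (k : ℕ) :
    IsProbabilityMeasure (A.dataLaw P k) := by
  induction k with
  | zero => exact Measure.dirac.isProbabilityMeasure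
  | succ k ih => exact Measure.isProbabilityMeasure_map (measurable_snoc k).aemeasurable

/-- The expectation of `F` over the label at `x`, after the data `D`. -/
def labelMean (P : Model d) {k : ℕ} (F : (Fin (k + 1) → Cube d × Bool) → ℝ)
    (w : (Fin k → Cube d × Bool) × Cube d) : ℝ :=
  P.labelProb (w.2, true) * F (Fin.snoc (α := fun _ => Cube d × Bool) w.1 (w.2, true)) +
    P.labelProb (w.2, false) * F (Fin.snoc (α := fun _ => Cube d × Bool) w.1 (w.2, false))

lemma measurable_labelMean (P : Model d) {k : ℕ} {F : (Fin (k + 1) → Cube d × Bool) → ℝ}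
    (hF : Measurable F) : Measurable (labelMean P F) := by
  have h (b : Bool) : Measurable fun w : (Fin k → Cube d × Bool) × Cube d =>
      P.labelProb (w.2, b) * F (Fin.snoc (α := fun _ => Cube d × Bool) w.1 (w.2, b)) :=
    (P.measurable_labelProb.comp (measurable_snd.prodMk measurable_const)).mul
      (hF.comp ((measurable_snoc k).comp
        (measurable_fst.prodMk (measurable_snd.prodMk measurable_const))))
  exact (h true).add (h false)

lemma abs_labelMean_le (P : Model d) {k : ℕ} {F : (Fin (k + 1) → Cube d × Bool) → ℝ} {C : ℝ}
    (hC : ∀ D, |F D| ≤ C) (w : (Fin k → Cube d × Bool) × Cube d) : |labelMean P F w| ≤ C := by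
  refine (abs_add_le _ _).trans ?_
  rw [abs_mul, abs_mul, abs_of_nonneg (P.labelProb_nonneg _), abs_of_nonneg (P.labelProb_nonneg _)]
  calc _ ≤ P.labelProb (w.2, true) * C + P.labelProb (w.2, false) * C := by
        gcongr
        · exact P.labelProb_nonneg _
        · exact hC _
        · exact P.labelProb_nonneg _
        · exact hC _
    _ = C := by rw [← add_mul, P.labelProb_add, one_mul]

lemma integrable_of_abs_le {α : Type*} [MeasurableSpace α] {μ : Measure α} [IsFiniteMeasure μ]
    {f : α → ℝ} (hf : Measurable f) {C : ℝ} (hC : ∀ x, |f x| ≤ C) : Integrable f μ :=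
  Integrable.of_bound hf.aestronglyMeasurable C (Filter.Eventually.of_forall hC)

/-- The expectation over the next query point and its label. -/
def stepMean (P : Model d) {k : ℕ} (F : (Fin (k + 1) → Cube d × Bool) → ℝ)
    (D : Fin k → Cube d × Bool) : ℝ :=
  ∫ x, labelMean P F (D, x) ∂A.query k D

lemma measurable_stepMean (P : Model d) {k : ℕ} {F : (Fin (k + 1) → Cube d × Bool) → ℝ}
    (hF : Measurable F) : Measurable (stepMean A P F) :=
  (StronglyMeasurable.integral_kernel_prod_right' (κ := A.query k)
    (measurable_labelMean P hF).stronglyMeasurable).measurable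

lemma abs_stepMean_le (P : Model d) {k : ℕ} {F : (Fin (k + 1) → Cube d × Bool) → ℝ} {C : ℝ}
    (hC : ∀ D, |F D| ≤ C) (D : Fin k → Cube d × Bool) : |stepMean A P F D| ≤ C := by
  have := norm_integral_le_of_norm_le_const (μ := A.query k D) (f := fun x => labelMean P F (D, x))
    (C := C) (Filter.Eventually.of_forall fun x => abs_labelMean_le P hC (D, x))
  simpa [stepMean] using this

lemma integral_dataLaw_succ (P : Model d) {k : ℕ} {F : (Fin (k + 1) → Cube d × Bool) → ℝ}
    (hF : Measurable F) {C : ℝ} (hC : ∀ D, |F D| ≤ C) :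
    ∫ D, F D ∂A.dataLaw P (k + 1) = ∫ D, stepMean A P F D ∂A.dataLaw P k := by
  have hG : Measurable fun w : (Fin k → Cube d × Bool) × (Cube d × Bool) =>
      F (Fin.snoc (α := fun _ => Cube d × Bool) w.1 w.2) := hF.comp (measurable_snoc k)
  rw [ActiveClassifier.dataLaw, integral_map (measurable_snoc k).aemeasurable
    hF.aestronglyMeasurable, Measure.integral_compProd (integrable_of_abs_le hG fun w => hC _)]
  refine integral_congr_ae (Filter.Eventually.of_forall fun D => ?_)
  have hGD : Measurable fun z : Cube d × Bool =>
      F (Fin.snoc (α := fun _ => Cube d × Bool) D z) := hG.comp measurable_prodMk_left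
  simp only [stepMean, labelMean]
  rw [integral_compProd (integrable_of_abs_le hGD fun w => hC _)]
  refine integral_congr_ae (Filter.Eventually.of_forall fun x => ?_)
  exact P.integral_label x fun y => F (Fin.snoc (α := fun _ => Cube d × Bool) D (x, y))

/-! ### Likelihood ratios -/

/-- The likelihood ratio of `P'` with respect to `P` of one label. -/
def labelRatio (P P' : Model d) (z : Cube d × Bool) : ℝ := P'.labelProb z / P.labelProb z

/-- The likelihood ratio of the data. The query distributions, being common, cancel. -/
def dataRatio (P P' : Model d) {k : ℕ} (D : Fin k → Cube d × Bool) : ℝ :=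
  ∏ j, labelRatio P P' (D j)

lemma measurable_labelRatio (P P' : Model d) : Measurable (labelRatio P P') :=
  P'.measurable_labelProb.div P.measurable_labelProb

lemma measurable_dataRatio (P P' : Model d) (k : ℕ) : Measurable (dataRatio P P' (k := k)) :=
  Finset.measurable_prod _ fun j _ => (measurable_labelRatio P P').comp (measurable_pi_apply j)

lemma dataRatio_snoc (P P' : Model d) {k : ℕ} (D : Fin k → Cube d × Bool) (z : Cube d × Bool) :
    dataRatio P P' (Fin.snoc (α := fun _ => Cube d × Bool) D z) =
      dataRatio P P' D * labelRatio P P' z := by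
  simp [dataRatio, Fin.prod_univ_castSucc]

variable {P P' : Model d}

lemma Model.labelProb_mem (hP : ∀ x : Cube d, |P.eta x| ≤ 1 / 2) (z : Cube d × Bool) :
    1 / 4 ≤ P.labelProb z ∧ P.labelProb z ≤ 3 / 4 := by
  have h := abs_le.1 (hP z.1)
  unfold Model.labelProb
  split_ifs <;> constructor <;> linarith

lemma labelRatio_mem (hP : ∀ x : Cube d, |P.eta x| ≤ 1 / 2)
    (hP' : ∀ x : Cube d, |P'.eta x| ≤ 1 / 2) (z : Cube d × Bool) :
    1 / 3 ≤ labelRatio P P' z ∧ labelRatio P P' z ≤ 3 := by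
  have h := Model.labelProb_mem hP z
  have h' := Model.labelProb_mem hP' z
  have h0 : 0 < P.labelProb z := by linarith
  unfold labelRatio
  constructor
  · rw [le_div_iff₀ h0]
    linarith
  · rw [div_le_iff₀ h0]
    linarith

lemma abs_dataRatio_le (hP : ∀ x : Cube d, |P.eta x| ≤ 1 / 2)
    (hP' : ∀ x : Cube d, |P'.eta x| ≤ 1 / 2) {k : ℕ} (D : Fin k → Cube d × Bool) :
    |dataRatio P P' D| ≤ 3 ^ k := by
  rw [dataRatio, Finset.abs_prod]
  refine (Finset.prod_le_prod (fun _ _ => abs_nonneg _) (g := fun _ => (3 : ℝ)) fun j _ => ?_).trans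
    (by simp)
  have h := labelRatio_mem hP hP' (D j)
  rw [abs_of_nonneg (by linarith)]
  exact h.2

/-- Change of measure between two models. -/
lemma integral_dataLaw_eq (hP : ∀ x : Cube d, |P.eta x| ≤ 1 / 2)
    (hP' : ∀ x : Cube d, |P'.eta x| ≤ 1 / 2) {k : ℕ} {F : (Fin k → Cube d × Bool) → ℝ}
    (hF : Measurable F) {C : ℝ} (hC : ∀ D, |F D| ≤ C) :
    ∫ D, F D ∂A.dataLaw P' k = ∫ D, dataRatio P P' D * F D ∂A.dataLaw P k := by
  induction k with
  | zero =>
    simp [ActiveClassifier.dataLaw, dataRatio]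
  | succ k ih =>
    have hC0 : 0 ≤ C := (abs_nonneg _).trans (hC fun _ => (⟨0, by simp⟩, true))
    have hUF : Measurable fun D : Fin (k + 1) → Cube d × Bool => dataRatio P P' D * F D :=
      (measurable_dataRatio P P' (k + 1)).mul hF
    rw [integral_dataLaw_succ A P' hF hC,
      ih (measurable_stepMean A P' hF) (abs_stepMean_le A P' hC),
      integral_dataLaw_succ A P hUF (C := 3 ^ (k + 1) * C)
        fun D => by
          rw [abs_mul]
          gcongr
          · exact abs_dataRatio_le hP hP' D
          · exact hC D]
    refine integral_congr_ae (Filter.Eventually.of_forall fun D => ?_)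
    simp only [stepMean]
    rw [← integral_const_mul]
    refine integral_congr_ae (Filter.Eventually.of_forall fun x => ?_)
    have h (b : Bool) : P.labelProb (x, b) * labelRatio P P' (x, b) = P'.labelProb (x, b) :=
      mul_div_cancel₀ _ (by linarith [(Model.labelProb_mem hP (x, b)).1])
    simp only [labelMean, dataRatio_snoc]
    rw [← h true, ← h false]
    ring

lemma integral_dataRatio (hP : ∀ x : Cube d, |P.eta x| ≤ 1 / 2)
    (hP' : ∀ x : Cube d, |P'.eta x| ≤ 1 / 2) (k : ℕ) :
    ∫ D, dataRatio P P' D ∂A.dataLaw P k = 1 := by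
  have := integral_dataLaw_eq A hP hP' (k := k) (F := fun _ => 1) measurable_const (C := 1)
    (by simp)
  simpa using this.symm

/-! ### Information contained in the labels -/

/-- The relative entropy of two label distributions, bounded by their `χ²`-distance. -/
lemma labelProb_mul_neg_log_le (hP : ∀ x : Cube d, |P.eta x| ≤ 1 / 2)
    (hP' : ∀ x : Cube d, |P'.eta x| ≤ 1 / 2) (x : Cube d) :
    P.labelProb (x, true) * -Real.log (labelRatio P P' (x, true)) +
      P.labelProb (x, false) * -Real.log (labelRatio P P' (x, false)) ≤
      4 / 3 * (P.eta x - P'.eta x) ^ 2 := by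
  have key (b : Bool) : P.labelProb (x, b) * -Real.log (labelRatio P P' (x, b)) ≤
      P.labelProb (x, b) * (P.labelProb (x, b) / P'.labelProb (x, b) - 1) := by
    have h := Model.labelProb_mem hP (x, b)
    have h' := Model.labelProb_mem hP' (x, b)
    refine mul_le_mul_of_nonneg_left ?_ (by linarith)
    rw [labelRatio, ← Real.log_inv, inv_div]
    exact Real.log_le_sub_one_of_pos (div_pos (by linarith) (by linarith))
  refine (add_le_add (key true) (key false)).trans ?_
  have h' := abs_le.1 (hP' x)
  simp only [Model.labelProb, if_true, Bool.false_eq_true, if_false]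
  set u := P.eta x
  set v := P'.eta x
  have h1 : 0 < 1 + v := by linarith
  have h2 : 0 < 1 - v := by linarith
  have h3 : (1 + u) / 2 * ((1 + u) / 2 / ((1 + v) / 2) - 1) +
      (1 - u) / 2 * ((1 - u) / 2 / ((1 - v) / 2) - 1) = (u - v) ^ 2 / ((1 + v) * (1 - v)) := by
    field_simp
    ring
  rw [h3, div_le_iff₀ (mul_pos h1 h2)]
  have h4 : 3 / 4 ≤ (1 + v) * (1 - v) := by nlinarith
  nlinarith [sq_nonneg (u - v)]

/-- The number of queries in the set `S`. -/
def queryCount (S : Set (Cube d)) {k : ℕ} (D : Fin k → Cube d × Bool) : ℝ :=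
  ∑ j, S.indicator (fun _ => (1 : ℝ)) (D j).1

lemma measurable_queryCount {S : Set (Cube d)} (hS : MeasurableSet S) (k : ℕ) :
    Measurable (queryCount S (k := k)) :=
  Finset.measurable_sum _ fun j _ => (measurable_const.indicator hS).comp
    (measurable_fst.comp (measurable_pi_apply j))

lemma abs_queryCount_le (S : Set (Cube d)) {k : ℕ} (D : Fin k → Cube d × Bool) :
    |queryCount S D| ≤ k := by
  refine (Finset.abs_sum_le_sum_abs _ _).trans ((Finset.sum_le_sum (g := fun _ => (1 : ℝ))
    fun j _ => ?_).trans (by simp))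
  by_cases h : (D j).1 ∈ S <;> simp [h]

lemma abs_log_labelRatio_le (hP : ∀ x : Cube d, |P.eta x| ≤ 1 / 2)
    (hP' : ∀ x : Cube d, |P'.eta x| ≤ 1 / 2) (z : Cube d × Bool) :
    |Real.log (labelRatio P P' z)| ≤ Real.log 3 := by
  have h := labelRatio_mem hP hP' z
  rw [abs_le, ← Real.log_inv]
  exact ⟨Real.log_le_log (by norm_num) (by linarith [h.1]), Real.log_le_log (by linarith) h.2⟩

lemma log_dataRatio (hP : ∀ x : Cube d, |P.eta x| ≤ 1 / 2)
    (hP' : ∀ x : Cube d, |P'.eta x| ≤ 1 / 2) {k : ℕ} (D : Fin k → Cube d × Bool) :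
    Real.log (dataRatio P P' D) = ∑ j, Real.log (labelRatio P P' (D j)) :=
  Real.log_prod fun j _ => by linarith [(labelRatio_mem hP hP' (D j)).1]

lemma abs_log_dataRatio_le (hP : ∀ x : Cube d, |P.eta x| ≤ 1 / 2)
    (hP' : ∀ x : Cube d, |P'.eta x| ≤ 1 / 2) {k : ℕ} (D : Fin k → Cube d × Bool) :
    |Real.log (dataRatio P P' D)| ≤ k * Real.log 3 := by
  rw [log_dataRatio hP hP']
  refine (Finset.abs_sum_le_sum_abs _ _).trans ((Finset.sum_le_sum
    fun j _ => abs_log_labelRatio_le hP hP' (D j)).trans (by simp))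

/-- The chain rule for the relative entropy of the data: only the labels of queries in the region
`S` where the models differ are informative. -/
lemma integral_neg_log_dataRatio_le (hP : ∀ x : Cube d, |P.eta x| ≤ 1 / 2)
    (hP' : ∀ x : Cube d, |P'.eta x| ≤ 1 / 2) {S : Set (Cube d)} (hS : MeasurableSet S) {τ : ℝ}
    (hτ : 0 ≤ τ) (hoff : ∀ x ∉ S, P.eta x = P'.eta x)
    (hon : ∀ x : Cube d, 4 / 3 * (P.eta x - P'.eta x) ^ 2 ≤ τ) (k : ℕ) :
    ∫ D, (-Real.log (dataRatio P P' D) - τ * queryCount S D) ∂A.dataLaw P k ≤ 0 := by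
  induction k with
  | zero =>
    simp [ActiveClassifier.dataLaw, dataRatio, queryCount]
  | succ k ih =>
    have hmeas (k : ℕ) : Measurable fun D : Fin k → Cube d × Bool =>
        -Real.log (dataRatio P P' D) - τ * queryCount S D :=
      (Real.measurable_log.comp (measurable_dataRatio P P' k)).neg.sub
        ((measurable_queryCount hS k).const_mul τ)
    have hbd (k : ℕ) (D : Fin k → Cube d × Bool) :
        |-Real.log (dataRatio P P' D) - τ * queryCount S D| ≤ k * Real.log 3 + τ * k := by
      refine (abs_sub _ _).trans ?_
      rw [abs_neg, abs_mul, abs_of_nonneg hτ]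
      gcongr
      · exact abs_log_dataRatio_le hP hP' D
      · exact abs_queryCount_le S D
    rw [integral_dataLaw_succ A P (hmeas (k + 1)) (hbd (k + 1))]
    refine (integral_mono
      (integrable_of_abs_le (measurable_stepMean A P (hmeas (k + 1)))
        (abs_stepMean_le A P (hbd (k + 1))))
      (integrable_of_abs_le (hmeas k) (hbd k)) fun D => ?_).trans ih
    have hle (x : Cube d) : labelMean P
        (fun D : Fin (k + 1) → Cube d × Bool =>
          -Real.log (dataRatio P P' D) - τ * queryCount S D) (D, x) ≤
        -Real.log (dataRatio P P' D) - τ * queryCount S D := by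
      have hl (b : Bool) :
          Real.log (dataRatio P P' (Fin.snoc (α := fun _ => Cube d × Bool) D (x, b)))
          = Real.log (dataRatio P P' D) + Real.log (labelRatio P P' (x, b)) := by
        rw [log_dataRatio hP hP', log_dataRatio hP hP', Fin.sum_univ_castSucc]
        simp
      have hq (b : Bool) : queryCount S (Fin.snoc (α := fun _ => Cube d × Bool) D (x, b))
          = queryCount S D + S.indicator (fun _ => (1 : ℝ)) x := by
        rw [queryCount, Fin.sum_univ_castSucc]
        simp [queryCount]
      have hinfo : P.labelProb (x, true) * -Real.log (labelRatio P P' (x, true)) +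
          P.labelProb (x, false) * -Real.log (labelRatio P P' (x, false)) ≤
          τ * S.indicator (fun _ => (1 : ℝ)) x := by
        refine (labelProb_mul_neg_log_le hP hP' x).trans ?_
        by_cases hx : x ∈ S
        · rw [indicator_of_mem hx, mul_one]
          exact hon x
        · rw [indicator_of_notMem hx, hoff x hx]
          simp
      have hsum := P.labelProb_add x
      simp only [labelMean, hl, hq]
      have e : P.labelProb (x, false) = 1 - P.labelProb (x, true) := by linarith
      rw [e] at hinfo ⊢
      linarith
    calc stepMean A P _ D ≤
        ∫ _x, (-Real.log (dataRatio P P' D) - τ * queryCount S D) ∂A.query k D :=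
          integral_mono
            (integrable_of_abs_le ((measurable_labelMean P (hmeas (k + 1))).comp
              measurable_prodMk_left) fun x => abs_labelMean_le P (hbd (k + 1)) (D, x))
            (integrable_const _) hle
      _ = _ := by simp

/-- A pointwise form of the Bretagnolle–Huber inequality, linear in `u` and `log u`. -/
lemma log_sub_le_min {u : ℝ} (hu : 0 < u) : 1 + 2 / 3 * Real.log u - u / 3 ≤ min 1 u := by
  have h2 := Real.log_le_sub_one_of_pos (show 0 < 2 * u by linarith)
  rw [Real.log_mul (by norm_num) hu.ne'] at h2
  have h3 := Real.log_two_gt_d9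
  have h4 := Real.log_le_sub_one_of_pos (show 0 < u / 2 by linarith)
  rw [Real.log_div hu.ne' (by norm_num)] at h4
  have h5 := Real.log_two_lt_d9
  refine le_min ?_ ?_
  · linarith
  · linarith

/-- Two-point testing bound: if two models differ only in `S`, then no test (with value `g` in
`[0, 1]`) has small errors of both kinds, unless it queries `S` often. -/
lemma integral_add_integral_ge (hP : ∀ x : Cube d, |P.eta x| ≤ 1 / 2)
    (hP' : ∀ x : Cube d, |P'.eta x| ≤ 1 / 2) {S : Set (Cube d)} (hS : MeasurableSet S) {τ : ℝ}
    (hτ : 0 ≤ τ) (hoff : ∀ x ∉ S, P.eta x = P'.eta x)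
    (hon : ∀ x : Cube d, 4 / 3 * (P.eta x - P'.eta x) ^ 2 ≤ τ) {k : ℕ}
    {g : (Fin k → Cube d × Bool) → ℝ} (hg : Measurable g) (hg0 : ∀ D, 0 ≤ g D)
    (hg1 : ∀ D, g D ≤ 1) :
    2 / 3 * (1 - τ * ∫ D, queryCount S D ∂A.dataLaw P k) ≤
      ∫ D, g D ∂A.dataLaw P k + ∫ D, (1 - g D) ∂A.dataLaw P' k := by
  have hU := measurable_dataRatio P P' k
  have hg' : Measurable fun D => 1 - g D := hg.const_sub 1
  have hgb (D) : |g D| ≤ 1 := by rw [abs_of_nonneg (hg0 D)]; exact hg1 D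
  have hgb' (D) : |1 - g D| ≤ 1 := abs_le.2 ⟨by linarith [hg1 D], by linarith [hg0 D]⟩
  have iU : Integrable (fun D : Fin k → Cube d × Bool => dataRatio P P' D) (A.dataLaw P k) :=
    integrable_of_abs_le hU (abs_dataRatio_le hP hP')
  have il : Integrable (fun D : Fin k → Cube d × Bool => Real.log (dataRatio P P' D))
      (A.dataLaw P k) :=
    integrable_of_abs_le (Real.measurable_log.comp hU) (abs_log_dataRatio_le hP hP')
  have il' : Integrable (fun D : Fin k → Cube d × Bool => -Real.log (dataRatio P P' D))
      (A.dataLaw P k) := il.neg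
  have iq : Integrable (fun D : Fin k → Cube d × Bool => queryCount S D) (A.dataLaw P k) :=
    integrable_of_abs_le (measurable_queryCount hS k) (abs_queryCount_le S)
  have ig : Integrable g (A.dataLaw P k) := integrable_of_abs_le hg hgb
  have iUg : Integrable (fun D => dataRatio P P' D * (1 - g D)) (A.dataLaw P k) :=
    integrable_of_abs_le (hU.mul hg') (C := 3 ^ k * 1) fun D => by
      rw [abs_mul]
      gcongr
      · exact abs_dataRatio_le hP hP' D
      · exact hgb' D
  have il1 : Integrable (fun D : Fin k → Cube d × Bool => 1 + 2 / 3 * Real.log (dataRatio P P' D))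
      (A.dataLaw P k) := (integrable_const 1).add (il.const_mul _)
  have hkl := integral_neg_log_dataRatio_le A hP hP' hS hτ hoff hon k
  rw [integral_sub il' (iq.const_mul τ), integral_neg, integral_const_mul] at hkl
  have hone := integral_dataRatio A hP hP' k
  rw [integral_dataLaw_eq A hP hP' hg' hgb', ← integral_add ig iUg]
  have hle : ∫ D, (1 + 2 / 3 * Real.log (dataRatio P P' D) - dataRatio P P' D / 3)
      ∂A.dataLaw P k ≤ ∫ D, (g D + dataRatio P P' D * (1 - g D)) ∂A.dataLaw P k := by
    refine integral_mono (il1.sub (iU.div_const 3))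
      (ig.add iUg) fun D => ?_
    have hpos : 0 < dataRatio P P' D :=
      Finset.prod_pos fun j _ => by linarith [(labelRatio_mem hP hP' (D j)).1]
    refine (log_sub_le_min hpos).trans ?_
    rcases le_total 1 (dataRatio P P' D) with h | h
    · rw [min_eq_left h]
      nlinarith [hg1 D]
    · rw [min_eq_right h]
      nlinarith [hg0 D]
  rw [integral_sub il1 (iU.div_const 3),
    integral_add (integrable_const 1) (il.const_mul _), integral_const_mul, integral_div, hone,
    integral_const, probReal_univ, one_smul] at hle
  linarith

end DataLaw

/-! ### The excess risk -/

/-- The conditional probability, given the cell `k` of level `M`, that the value of the classifier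
`f` is not `b`. -/
def cellError (M : ℕ) (k : Fin d → Fin (2 ^ M)) (f : Cube d → Bool) (b : Bool) : ℝ :=
  (cellUniform M k).real {x | f x ≠ b}

lemma measurableSet_ne {α : Type*} [MeasurableSpace α] {f : α → Bool} (hf : Measurable f)
    (b : Bool) : MeasurableSet {x | f x ≠ b} :=
  (hf (measurableSet_singleton b)).compl

lemma cellError_not {M : ℕ} (k : Fin d → Fin (2 ^ M)) {f : Cube d → Bool} (hf : Measurable f)
    (b : Bool) : cellError M k f (!b) = 1 - cellError M k f b := by
  have : {x | f x ≠ !b} = {x | f x ≠ b}ᶜ := by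
    ext x
    simp
  rw [cellError, cellError, this, probReal_compl_eq_one_sub (measurableSet_ne hf b)]

lemma cellError_nonneg {M : ℕ} (k : Fin d → Fin (2 ^ M)) (f : Cube d → Bool) (b : Bool) :
    0 ≤ cellError M k f b := measureReal_nonneg

lemma cellError_le_one {M : ℕ} (k : Fin d → Fin (2 ^ M)) (f : Cube d → Bool) (b : Bool) :
    cellError M k f b ≤ 1 := measureReal_le_one

lemma ActiveClassifier.measurable_classify_apply {N : ℕ} (A : ActiveClassifier d N)
    (D : Fin N → Cube d × Bool) : Measurable (A.classify D) :=
  A.measurable_classify.comp measurable_prodMk_left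

lemma measurable_cellError {N : ℕ} (A : ActiveClassifier d N) {M : ℕ} (k : Fin d → Fin (2 ^ M))
    (b : Bool) : Measurable fun D => cellError M k (A.classify D) b :=
  (measurable_measure_prodMk_left (ν := cellUniform M k)
    (measurableSet_ne A.measurable_classify b)).ennreal_toReal

lemma Model.label_ne (P : Model d) (x : Cube d) (b : Bool) :
    P.label x {y | y ≠ b} = ENNReal.ofReal (P.labelProb (x, !b)) := by
  rw [P.label_apply]
  cases b <;> simp

lemma Model.risk_eq_integral (P : Model d) {f : Cube d → Bool} (hf : Measurable f) :
    P.risk f = ∫ x, P.labelProb (x, !f x) ∂P.marginal := by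
  have hpr : IsProbabilityMeasure P.marginal := P.isProbabilityMeasure_marginal
  have hS : MeasurableSet {z : Cube d × Bool | z.2 ≠ f z.1} :=
    (measurableSet_eq_fun measurable_snd (hf.comp measurable_fst)).compl
  have hm : Measurable fun x : Cube d => P.labelProb (x, !f x) :=
    P.measurable_labelProb.comp (measurable_id.prodMk ((measurable_of_finite Bool.not).comp hf))
  rw [Model.risk, Model.law, measureReal_def, Measure.compProd_apply hS,
    integral_eq_lintegral_of_nonneg_ae (Filter.Eventually.of_forall fun x => P.labelProb_nonneg _)
      hm.aestronglyMeasurable]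
  congr 1
  exact lintegral_congr fun x => P.label_ne x (f x)

section Risk

variable {ι : Type*} [Fintype ι] {M : ℕ} {P : Model d} {p : ι → ℝ}
  {κ : ι → Fin d → Fin (2 ^ M)} {v : ι → ℝ}

lemma IsCellModel.risk_eq (h : IsCellModel P p κ v) {f : Cube d → Bool} (hf : Measurable f) :
    P.risk f = ∑ k, p k * ((1 - |v k|) / 2 +
      |v k| * cellError M (κ k) f (decide (0 ≤ v k))) := by
  have hm : Measurable fun x : Cube d => P.labelProb (x, !f x) :=
    P.measurable_labelProb.comp (measurable_id.prodMk ((measurable_of_finite Bool.not).comp hf))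
  rw [P.risk_eq_integral hf, h.marginal_eq, integral_cellMixture (fun k => (h.pos k).le) fun k =>
    integrable_of_abs_le hm (C := 1) fun x => by
      rw [abs_of_nonneg (P.labelProb_nonneg _)]
      exact P.labelProb_le_one _]
  refine Finset.sum_congr rfl fun k _ => ?_
  congr 1
  set b := decide (0 ≤ v k) with hb
  have hS := measurableSet_ne hf b
  have hae : ∀ᵐ x ∂cellUniform M (κ k), P.labelProb (x, !f x) =
      (1 - |v k|) / 2 + |v k| * {x | f x ≠ b}.indicator (fun _ => (1 : ℝ)) x := by
    filter_upwards [ae_cellUniform_mem M (κ k)] with x hx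
    have hη := h.eta_eq k x (cell_subset_closedCell _ _ hx)
    simp only [Model.labelProb, hη, indicator_apply, mem_ofPred_eq]
    rcases le_or_gt 0 (v k) with hv | hv
    · have : b = true := by simp [hb, hv]
      rw [this, abs_of_nonneg hv]
      rcases Bool.eq_false_or_eq_true (f x) with hfx | hfx <;> simp [hfx]
      ring
    · have : b = false := by simp [hb, hv]
      rw [this, abs_of_neg hv]
      rcases Bool.eq_false_or_eq_true (f x) with hfx | hfx <;> simp [hfx]
      ring
  rw [integral_congr_ae hae, integral_add (integrable_const _)
    (((integrable_const 1).indicator hS).const_mul _), integral_const, integral_const_mul,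
    integral_indicator_const _ hS, probReal_univ, one_smul, smul_eq_mul, mul_one]
  rfl

/-- The Bayes classifier makes no error on the cells. -/
lemma IsCellModel.bayesRisk_le (h : IsCellModel P p κ v) :
    P.bayesRisk ≤ ∑ k, p k * ((1 - |v k|) / 2) := by
  have hf : Measurable fun x : Cube d => decide (0 ≤ P.eta x) :=
    measurable_to_bool (by
      have : ((fun x : Cube d => decide (0 ≤ P.eta x)) ⁻¹' {true}) =
          {x : Cube d | 0 ≤ P.eta x} := by
        ext x
        simp
      rw [this]
      exact measurableSet_le measurable_const P.measurable_eta_coe)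
  refine (ciInf_le ⟨0, ?_⟩ (⟨_, hf⟩ : {f : Cube d → Bool // Measurable f})).trans_eq ?_
  · rintro _ ⟨f, rfl⟩
    exact measureReal_nonneg
  · rw [h.risk_eq hf]
    refine Finset.sum_congr rfl fun k _ => ?_
    have : cellError M (κ k) (fun x : Cube d => decide (0 ≤ P.eta x)) (decide (0 ≤ v k)) = 0 := by
      rw [cellError, measureReal_def, measure_eq_zero_iff_ae_notMem.2, ENNReal.toReal_zero]
      filter_upwards [ae_cellUniform_mem M (κ k)] with x hx hx'
      exact hx' (by rw [h.eta_eq k x (cell_subset_closedCell _ _ hx)])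
    rw [this, mul_zero, add_zero]

/-- The expected excess risk is at least the weighted error on the cells. -/
lemma IsCellModel.sum_le_expectedRisk_sub (h : IsCellModel P p κ v) {N : ℕ}
    (A : ActiveClassifier d N) :
    ∑ k, p k * |v k| * ∫ D, cellError M (κ k) (A.classify D) (decide (0 ≤ v k)) ∂A.dataLaw P N ≤
      A.expectedRisk P - P.bayesRisk := by
  have hi (k : ι) : Integrable (fun D => cellError M (κ k) (A.classify D) (decide (0 ≤ v k)))
      (A.dataLaw P N) :=
    integrable_of_abs_le (measurable_cellError A _ _) (C := 1) fun D => by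
      rw [abs_of_nonneg (cellError_nonneg _ _ _)]
      exact cellError_le_one _ _ _
  have hE : A.expectedRisk P = ∑ k, p k * ((1 - |v k|) / 2 +
      |v k| * ∫ D, cellError M (κ k) (A.classify D) (decide (0 ≤ v k)) ∂A.dataLaw P N) := by
    have h1 (D : Fin N → Cube d × Bool) := h.risk_eq (A.measurable_classify_apply D)
    simp only [ActiveClassifier.expectedRisk, h1]
    have h2 (k : ι) : Integrable (fun D => (1 - |v k|) / 2 +
        |v k| * cellError M (κ k) (A.classify D) (decide (0 ≤ v k))) (A.dataLaw P N) :=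
      (integrable_const _).add ((hi k).const_mul _)
    rw [integral_finsetSum _ fun k _ => (h2 k).const_mul _]
    refine Finset.sum_congr rfl fun k _ => ?_
    rw [integral_const_mul, integral_add (integrable_const _) ((hi k).const_mul _),
      integral_const_mul, integral_const, probReal_univ, one_smul]
  rw [hE]
  refine le_trans (le_of_eq ?_) (sub_le_sub_left h.bayesRisk_le _)
  rw [← Finset.sum_sub_distrib]
  exact Finset.sum_congr rfl fun k _ => by ring

end Risk

lemma expectedRisk_sub_bayesRisk_le_one {N : ℕ} (A : ActiveClassifier d N) (P : Model d) :
    A.expectedRisk P - P.bayesRisk ≤ 1 := by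
  have hpr : IsProbabilityMeasure P.law := by unfold Model.law; infer_instance
  have h1 : A.expectedRisk P ≤ 1 := by
    refine (le_abs_self _).trans ?_
    have := norm_integral_le_of_norm_le_const (μ := A.dataLaw P N)
      (f := fun D => P.risk (A.classify D)) (C := 1) (Filter.Eventually.of_forall fun D => by
        rw [Model.risk, Real.norm_of_nonneg measureReal_nonneg]
        exact measureReal_le_one)
    simpa [ActiveClassifier.expectedRisk] using this
  have h2 : 0 ≤ P.bayesRisk := Real.iInf_nonneg fun f => measureReal_nonneg
  linarith

/-! ### A hypercube of models -/

/-- The sign encoded by a label. -/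
def boolSign (b : Bool) : ℝ := if b then 1 else -1

lemma abs_boolSign (b : Bool) : |boolSign b| = 1 := by cases b <;> simp [boolSign]

/-- The cells of level `r + 3` that carry the marginal: one in the plateau of each of the `2^(dr)`
small bumps, and the `2^(dr)` subcells of `[5/8, 3/4]^d`, in the plateau of the large bump. -/
def hardCell (d r : ℕ) : (Fin d → Fin (2 ^ r)) ⊕ (Fin d → Fin (2 ^ r)) →
    Fin d → Fin (2 ^ (r + 3)) :=
  Sum.elim (fun i j => ⟨4 * i j + 1, by have := (i j).2; rw [pow_add]; omega⟩)
    (fun i j => ⟨5 * 2 ^ r + i j, by have := (i j).2; rw [pow_add]; omega⟩)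

/-- Mass `ε` is spread over the small bumps and mass `1 - ε` over the large one. -/
def hardWeight (d r : ℕ) (ε : ℝ) : (Fin d → Fin (2 ^ r)) ⊕ (Fin d → Fin (2 ^ r)) → ℝ :=
  Sum.elim (fun _ => ε / 2 ^ (r * d)) (fun _ => (1 - ε) / 2 ^ (r * d))

/-- The values of the regression function on the cells. -/
def hardValue {r : ℕ} (a c : ℝ) (σ : (Fin d → Fin (2 ^ r)) → Bool) :
    (Fin d → Fin (2 ^ r)) ⊕ (Fin d → Fin (2 ^ r)) → ℝ :=
  Sum.elim (fun i => a * boolSign (σ i)) (fun _ => c)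

lemma sum_const_div_card (d r : ℕ) (x : ℝ) :
    ∑ _i : Fin d → Fin (2 ^ r), x / 2 ^ (r * d) = x := by
  rw [Finset.sum_const, Finset.card_univ, Fintype.card_fun, Fintype.card_fin, Fintype.card_fin,
    nsmul_eq_mul, ← pow_mul]
  push_cast
  field_simp

lemma sum_hardWeight (d r : ℕ) (ε : ℝ) : ∑ k, hardWeight d r ε k = 1 := by
  rw [Fintype.sum_sum_type]
  simp only [hardWeight, Sum.elim_inl, Sum.elim_inr]
  rw [sum_const_div_card, sum_const_div_card]
  ring

lemma abs_regFun_le {r : ℕ} {a c : ℝ} (ha : 0 ≤ a) (hc : 0 ≤ c)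
    (σ : (Fin d → Fin (2 ^ r)) → Bool) (x : Fin d → ℝ) :
    |regFun r a c (fun i => boolSign (σ i)) x| ≤ a + c := by
  refine (abs_add_le _ _).trans ?_
  rw [abs_mul, abs_mul, abs_of_nonneg ha, abs_of_nonneg hc, abs_of_nonneg (unitBump d).nonneg]
  exact add_le_add (mul_le_of_le_one_right ha (abs_bumpSum_le (fun i => (abs_boolSign _).le) _))
    (mul_le_of_le_one_right hc (unitBump d).le_one)

lemma regFun_eq_hardValue (hd : 0 < d) {r : ℕ} (a c : ℝ) (σ : (Fin d → Fin (2 ^ r)) → Bool)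
    (k : (Fin d → Fin (2 ^ r)) ⊕ (Fin d → Fin (2 ^ r))) {x : Cube d}
    (hx : x ∈ closedCell (r + 3) (hardCell d r k)) :
    regFun r a c (fun i => boolSign (σ i)) x = hardValue a c σ k := by
  have h2 : (0 : ℝ) < 2 ^ r := by positivity
  have hball {z : Fin d → ℝ} (hz : ∀ j, 1 / 4 ≤ z j ∧ z j ≤ 1 / 2) :
      z ∈ Metric.closedBall (fun _ : Fin d => (1 / 2 : ℝ)) (1 / 4) := by
    rw [Metric.mem_closedBall, dist_pi_le_iff (by norm_num)]
    intro j
    rw [Real.dist_eq, abs_le]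
    constructor <;> linarith [(hz j).1, (hz j).2]
  have hout {z : Fin d → ℝ} (j : Fin d) (hz : z j ≤ 0 ∨ 1 ≤ z j) :
      z ∉ Metric.closedBall (fun _ : Fin d => (1 / 2 : ℝ)) (3 / 8) := by
    intro h
    rw [Metric.mem_closedBall, dist_pi_le_iff (by norm_num)] at h
    have := abs_le.1 (h j)
    rcases hz with hz | hz <;> linarith [this.1, this.2]
  have hx' (j : Fin d) :
      ((hardCell d r k j : ℕ) : ℝ) ≤ x.1 j * (2 ^ r * 8) ∧
        x.1 j * (2 ^ r * 8) ≤ ((hardCell d r k j : ℕ) : ℝ) + 1 := by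
    have h8 : (2 : ℝ) ^ (r + 3) = 2 ^ r * 8 := by
      rw [pow_add]
      norm_num
    rw [← h8]
    exact ⟨(div_le_iff₀ (by positivity)).1 (hx j).1, (le_div_iff₀ (by positivity)).1 (hx j).2⟩
  unfold regFun
  rcases k with i | i
  · have hk (j : Fin d) : ((hardCell d r (Sum.inl i) j : ℕ) : ℝ) = 4 * (i j : ℕ) + 1 := by
      simp [hardCell]
    have h1 : (2 : ℝ) ^ (r + 1) • x.1 - gridPoint i ∈
        Metric.closedBall (fun _ : Fin d => (1 / 2 : ℝ)) (1 / 4) := by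
      refine hball fun j => ?_
      have := hx' j
      rw [hk] at this
      simp only [Pi.sub_apply, Pi.smul_apply, smul_eq_mul, gridPoint, pow_succ]
      constructor <;> linarith [this.1, this.2]
    rw [bumpSum_eq_of_near _ (Metric.closedBall_subset_closedBall (by norm_num) h1),
      (unitBump d).one_of_mem_closedBall h1, unitBump_eq_zero]
    · simp [hardValue]
    · refine hout ⟨0, hd⟩ (Or.inl ?_)
      have := hx' ⟨0, hd⟩
      rw [hk] at this
      have hi : ((i ⟨0, hd⟩ : ℕ) : ℝ) + 1 ≤ 2 ^ r := by exact_mod_cast (i ⟨0, hd⟩).2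
      simp only [Pi.sub_apply, Pi.smul_apply, smul_eq_mul, Pi.one_apply]
      by_contra! hcon
      nlinarith [this.2]
  · have hk (j : Fin d) :
        ((hardCell d r (Sum.inr i) j : ℕ) : ℝ) = 5 * 2 ^ r + (i j : ℕ) := by
      simp [hardCell]
    have h1 : (2 : ℝ) • x.1 - 1 ∈ Metric.closedBall (fun _ : Fin d => (1 / 2 : ℝ)) (1 / 4) := by
      refine hball fun j => ?_
      have := hx' j
      rw [hk] at this
      have hi : ((i j : ℕ) : ℝ) + 1 ≤ 2 ^ r := by exact_mod_cast (i j).2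
      have hi0 : (0 : ℝ) ≤ ((i j : ℕ) : ℝ) := Nat.cast_nonneg _
      simp only [Pi.sub_apply, Pi.smul_apply, smul_eq_mul, Pi.one_apply]
      constructor
      · by_contra! hcon
        nlinarith [this.1]
      · by_contra! hcon
        nlinarith [this.2]
    rw [(unitBump d).one_of_mem_closedBall h1, bumpSum_eq_zero]
    · simp [hardValue]
    · intro i'
      refine hout ⟨0, hd⟩ (Or.inr ?_)
      have := hx' ⟨0, hd⟩
      rw [hk] at this
      have hi : ((i' ⟨0, hd⟩ : ℕ) : ℝ) + 1 ≤ 2 ^ r := by exact_mod_cast (i' ⟨0, hd⟩).2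
      have hi0 : (0 : ℝ) ≤ ((i ⟨0, hd⟩ : ℕ) : ℝ) := Nat.cast_nonneg _
      simp only [Pi.sub_apply, Pi.smul_apply, smul_eq_mul, gridPoint, pow_succ]
      linarith [this.1]

/-- The models indexed by the sign patterns `σ` share their marginal. -/
lemma exists_hardModel (hd : 0 < d) (r : ℕ) {a c ε : ℝ} (ha : 0 ≤ a) (hc : 0 ≤ c)
    (hac : a + c ≤ 1) (hε : 0 < ε) (hε1 : ε < 1) (σ : (Fin d → Fin (2 ^ r)) → Bool) :
    ∃ P : Model d, P.eta = regFun r a c (fun i => boolSign (σ i)) ∧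
      IsCellModel P (hardWeight d r ε) (hardCell d r) (hardValue a c σ) := by
  have hpos (k : (Fin d → Fin (2 ^ r)) ⊕ (Fin d → Fin (2 ^ r))) : 0 < hardWeight d r ε k := by
    rcases k with i | i
    · exact div_pos hε (by positivity)
    · exact div_pos (sub_pos.2 hε1) (by positivity)
  exact ⟨⟨cellMixture (hardWeight d r ε) (hardCell d r),
    isProbabilityMeasure_cellMixture (fun k => (hpos k).le) (sum_hardWeight d r ε),
    regFun r a c (fun i => boolSign (σ i)), (contDiff_regFun r a c _ 0).continuous.measurable,
    fun x => (abs_regFun_le ha hc σ x).trans hac⟩, rfl,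
    ⟨hpos, sum_hardWeight d r ε, rfl, fun k x hx => regFun_eq_hardValue hd a c σ k hx⟩⟩

/-- The height `s c` of the small bumps and their mass `s ^ γ / 2` are balanced such that the low
noise condition holds with a constant independent of `s`. -/
lemma sum_hardWeight_le {r : ℕ} {c s γ B : ℝ} (hc : 0 < c) (hs : 0 < s) (hs1 : s ≤ 1) (hγ : 0 < γ)
    (hB : c ^ (-γ) ≤ B) (σ : (Fin d → Fin (2 ^ r)) → Bool) {t : ℝ} (ht : 0 < t) :
    ∑ k with |hardValue (c * s) c σ k| ≤ t, hardWeight d r (s ^ γ / 2) k ≤ B * t ^ γ := by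
  have hcs : 0 < c * s := by positivity
  have hsγ : 0 < s ^ γ := by positivity
  have hsγ1 : s ^ γ ≤ 1 := Real.rpow_le_one hs.le hs1 hγ.le
  have hBt {y : ℝ} (hy : 0 ≤ y) (hyt : c * y ≤ t) : y ^ γ ≤ B * t ^ γ := by
    calc y ^ γ ≤ (t / c) ^ γ := by
          gcongr
          rwa [le_div_iff₀ hc, mul_comm]
      _ = c ^ (-γ) * t ^ γ := by
          rw [Real.div_rpow ht.le hc.le, Real.rpow_neg hc.le]
          ring
      _ ≤ _ := by gcongr
  rw [Finset.sum_filter, Fintype.sum_sum_type]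
  simp only [hardValue, hardWeight, Sum.elim_inl, Sum.elim_inr, abs_mul, abs_boolSign, mul_one,
    abs_of_pos hc, abs_of_pos hs]
  by_cases h1 : c * s ≤ t
  · by_cases h2 : c ≤ t
    · simp only [if_pos h1, if_pos h2]
      rw [sum_const_div_card, sum_const_div_card]
      have := hBt zero_le_one (by rwa [mul_one])
      rw [Real.one_rpow] at this
      linarith
    · simp only [if_pos h1, if_neg h2, Finset.sum_const_zero, add_zero]
      rw [sum_const_div_card]
      linarith [hBt hs.le h1]
  · have h2 : ¬ c ≤ t := fun h2 => h1 ((mul_le_of_le_one_right hc.le hs1).trans h2)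
    simp only [if_neg h1, if_neg h2, Finset.sum_const_zero, add_zero]
    have := hBt le_rfl (by rw [mul_zero]; exact ht.le)
    rwa [Real.zero_rpow hγ.ne'] at this

/-- The part of the cube where the small bump with index `i` may be nonzero. -/
def bumpRegion (r : ℕ) (i : Fin d → Fin (2 ^ r)) : Set (Cube d) :=
  {x | (2 : ℝ) ^ (r + 1) • x.1 - gridPoint i ∈
    Metric.closedBall (fun _ : Fin d => (1 / 2 : ℝ)) (3 / 8)}

lemma measurableSet_bumpRegion (r : ℕ) (i : Fin d → Fin (2 ^ r)) :
    MeasurableSet (bumpRegion r i) := by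
  have hc : Continuous fun x : Cube d => (2 : ℝ) ^ (r + 1) • x.1 - gridPoint i := by
    fun_prop
  exact (Metric.isClosed_closedBall.preimage hc).measurableSet

lemma sum_queryCount_bumpRegion_le {r k : ℕ} (D : Fin k → Cube d × Bool) :
    ∑ i, queryCount (bumpRegion r i) D ≤ k := by
  unfold queryCount
  rw [Finset.sum_comm]
  refine (Finset.sum_le_sum (g := fun _ => (1 : ℝ)) fun j _ => ?_).trans (by simp)
  by_cases h : ∃ i, (D j).1 ∈ bumpRegion r i
  · obtain ⟨i, hi⟩ := h
    have h0 (i' : Fin d → Fin (2 ^ r)) (hi' : i' ≠ i) :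
        (bumpRegion r i').indicator (fun _ => (1 : ℝ)) (D j).1 = 0 :=
      indicator_of_notMem (fun h' : (D j).1 ∈ bumpRegion r i' =>
        hi' (gridPoint_injective_of_near h' hi)) _
    rw [Finset.sum_eq_single i (fun i' _ => h0 i') (fun h => absurd (Finset.mem_univ i) h),
      indicator_of_mem hi]
  · rw [Finset.sum_eq_zero fun i _ => indicator_of_notMem (not_exists.1 h i) _]
    exact zero_le_one

/-- The sign pattern with the sign at `i` reversed. -/
def flipAt {J : Type*} [DecidableEq J] (i : J) (σ : J → Bool) : J → Bool :=
  Function.update σ i (!σ i)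

lemma flipAt_involutive {J : Type*} [DecidableEq J] (i : J) :
    Function.Involutive (flipAt i : (J → Bool) → J → Bool) := by
  intro σ
  simp [flipAt]

lemma regFun_flipAt_eq {r : ℕ} (a c : ℝ) (σ : (Fin d → Fin (2 ^ r)) → Bool)
    {i : Fin d → Fin (2 ^ r)} {x : Cube d} (hx : x ∉ bumpRegion r i) :
    regFun r a c (fun i => boolSign (σ i)) x =
      regFun r a c (fun j => boolSign (flipAt i σ j)) x := by
  unfold regFun bumpSum
  congr 2
  refine Finset.sum_congr rfl fun j _ => ?_
  by_cases hj : j = i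
  · subst hj
    rw [unitBump_eq_zero hx, mul_zero, mul_zero]
  · simp only [flipAt, Function.update_of_ne hj]

lemma sq_regFun_sub_le {r : ℕ} (a c : ℝ) (σ σ' : (Fin d → Fin (2 ^ r)) → Bool)
    (x : Fin d → ℝ) :
    (regFun r a c (fun i => boolSign (σ i)) x - regFun r a c (fun i => boolSign (σ' i)) x) ^ 2 ≤
      4 * a ^ 2 := by
  have h1 := abs_le.1 (abs_bumpSum_le (fun i => (abs_boolSign (σ i)).le) ((2 : ℝ) ^ (r + 1) • x))
  have h2 := abs_le.1 (abs_bumpSum_le (fun i => (abs_boolSign (σ' i)).le) ((2 : ℝ) ^ (r + 1) • x))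
  have : regFun r a c (fun i => boolSign (σ i)) x - regFun r a c (fun i => boolSign (σ' i)) x =
      a * (bumpSum (fun i => boolSign (σ i)) ((2 : ℝ) ^ (r + 1) • x) -
        bumpSum (fun i => boolSign (σ' i)) ((2 : ℝ) ^ (r + 1) • x)) := by
    unfold regFun
    ring
  rw [this, mul_pow, mul_comm (4 : ℝ)]
  gcongr
  rw [show (4 : ℝ) = 2 ^ 2 by norm_num]
  exact sq_le_sq' (by linarith) (by linarith)

/-! ### The lower bound -/

/-- Assouad's argument: with few labels, the excess risk averaged over all sign patterns is at
least a fixed fraction of the risk `ε a` at stake in the small bumps. -/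
lemma le_sum_excessRisk {r N : ℕ} {a c ε : ℝ} (ha : 0 < a) (hc : 0 < c) (hac : a + c ≤ 1 / 2)
    (hε : 0 < ε) {P : ((Fin d → Fin (2 ^ r)) → Bool) → Model d}
    (hη : ∀ σ, (P σ).eta = regFun r a c (fun i => boolSign (σ i)))
    (hP : ∀ σ, IsCellModel (P σ) (hardWeight d r ε) (hardCell d r) (hardValue a c σ))
    (A : ActiveClassifier d N) (hN : 16 / 3 * a ^ 2 * N ≤ 2 ^ (r * d) / 2) :
    ∑ _σ : (Fin d → Fin (2 ^ r)) → Bool, ε * a / 6 ≤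
      ∑ σ, (A.expectedRisk (P σ) - (P σ).bayesRisk) := by
  set n : ℝ := 2 ^ (r * d) with hn
  have hn0 : 0 < n := by positivity
  set τ : ℝ := 16 / 3 * a ^ 2 with hτ
  have hτ0 : 0 ≤ τ := by positivity
  have hcard : ((Finset.univ : Finset (Fin d → Fin (2 ^ r))).card : ℝ) = n := by
    rw [Finset.card_univ, Fintype.card_fun, Fintype.card_fin, Fintype.card_fin, ← pow_mul, hn]
    push_cast
    rfl
  have hhalf (σ : (Fin d → Fin (2 ^ r)) → Bool) (x : Cube d) : |(P σ).eta x| ≤ 1 / 2 := by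
    rw [hη]
    exact (abs_regFun_le ha.le hc.le σ x).trans hac
  -- the error at the `i`-th bump, and the expected number of queries there
  set E : ((Fin d → Fin (2 ^ r)) → Bool) → (Fin d → Fin (2 ^ r)) → ℝ := fun σ i =>
    ∫ D, cellError (r + 3) (hardCell d r (Sum.inl i)) (A.classify D) (σ i) ∂A.dataLaw (P σ) N
    with hE
  set Q : ((Fin d → Fin (2 ^ r)) → Bool) → (Fin d → Fin (2 ^ r)) → ℝ := fun σ i =>
    ∫ D, queryCount (bumpRegion r i) D ∂A.dataLaw (P σ) N with hQ
  have hpair (σ : (Fin d → Fin (2 ^ r)) → Bool) (i : Fin d → Fin (2 ^ r)) :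
      2 / 3 * (1 - τ * Q σ i) ≤ E σ i + E (flipAt i σ) i := by
    have h := integral_add_integral_ge A (hhalf σ) (hhalf (flipAt i σ))
      (measurableSet_bumpRegion r i) hτ0
      (fun x hx => by rw [hη, hη]; exact regFun_flipAt_eq a c σ hx)
      (fun x => by
        rw [hη, hη, hτ]
        linarith [sq_regFun_sub_le a c σ (flipAt i σ) x]) (k := N)
      (measurable_cellError A (hardCell d r (Sum.inl i)) (σ i))
      (fun D => cellError_nonneg _ _ _) (fun D => cellError_le_one _ _ _)
    refine h.trans_eq ?_
    simp only [hE]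
    congr 1
    refine integral_congr_ae (Filter.Eventually.of_forall fun D => ?_)
    have : flipAt i σ i = !σ i := by simp [flipAt]
    simp only [this]
    rw [cellError_not _ (A.measurable_classify_apply D)]
  have hsum (i : Fin d → Fin (2 ^ r)) :
      ∑ σ, 1 / 3 * (1 - τ * Q σ i) ≤ ∑ σ, E σ i := by
    have h1 : ∑ σ, E (flipAt i σ) i = ∑ σ, E σ i :=
      Equiv.sum_comp (flipAt_involutive i).toPerm fun σ => E σ i
    have h2 := Finset.sum_le_sum fun σ (_ : σ ∈ Finset.univ) => hpair σ i
    rw [Finset.sum_add_distrib, h1] at h2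
    have h3 : ∑ σ, 2 / 3 * (1 - τ * Q σ i) = 2 * ∑ σ, 1 / 3 * (1 - τ * Q σ i) := by
      rw [Finset.mul_sum]
      exact Finset.sum_congr rfl fun σ _ => by ring
    linarith
  have hQN (σ : (Fin d → Fin (2 ^ r)) → Bool) : ∑ i, Q σ i ≤ N := by
    have hi (i : Fin d → Fin (2 ^ r)) : Integrable
        (fun D : Fin N → Cube d × Bool => queryCount (bumpRegion r i) D) (A.dataLaw (P σ) N) :=
      integrable_of_abs_le (measurable_queryCount (measurableSet_bumpRegion r i) N)
        (abs_queryCount_le _)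
    simp only [hQ]
    rw [← integral_finsetSum _ fun i _ => hi i]
    refine (integral_mono (integrable_finsetSum _ fun i _ => hi i) (integrable_const (N : ℝ))
      fun D => sum_queryCount_bumpRegion_le D).trans (by simp)
  have hexc (σ : (Fin d → Fin (2 ^ r)) → Bool) :
      ε / n * a * ∑ i, E σ i ≤ A.expectedRisk (P σ) - (P σ).bayesRisk := by
    refine le_trans ?_ ((hP σ).sum_le_expectedRisk_sub A)
    rw [Fintype.sum_sum_type, Finset.mul_sum]
    have hnn : 0 ≤ ∑ i : Fin d → Fin (2 ^ r), hardWeight d r ε (Sum.inr i) *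
        |hardValue a c σ (Sum.inr i)| * ∫ D, cellError (r + 3) (hardCell d r (Sum.inr i))
          (A.classify D) (decide (0 ≤ hardValue a c σ (Sum.inr i))) ∂A.dataLaw (P σ) N :=
      Finset.sum_nonneg fun i _ => mul_nonneg (mul_nonneg ((hP σ).pos _).le (abs_nonneg _))
        (integral_nonneg fun D => cellError_nonneg _ _ _)
    refine le_add_of_le_of_nonneg (le_of_eq (Finset.sum_congr rfl fun i _ => ?_)) hnn
    have hdec : decide (0 ≤ hardValue a c σ (Sum.inl i)) = σ i := by
      simp only [hardValue, Sum.elim_inl]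
      rcases Bool.eq_false_or_eq_true (σ i) with h | h
      · simpa [h, boolSign] using ha.le
      · simpa [h, boolSign] using ha
    rw [hdec]
    simp only [hardWeight, hardValue, Sum.elim_inl, abs_mul, abs_boolSign, mul_one, abs_of_pos ha,
      hE, hn]
  refine le_trans ?_ (Finset.sum_le_sum fun σ _ => hexc σ)
  rw [← Finset.mul_sum, Finset.sum_comm]
  have h1 : ∑ _σ : (Fin d → Fin (2 ^ r)) → Bool, n / 6 ≤ ∑ i, ∑ σ, E σ i := by
    refine le_trans ?_ (Finset.sum_le_sum fun i _ => hsum i)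
    rw [Finset.sum_comm]
    refine Finset.sum_le_sum fun σ _ => ?_
    rw [← Finset.mul_sum, Finset.sum_sub_distrib, ← Finset.mul_sum, Finset.sum_const, nsmul_eq_mul,
      mul_one, hcard]
    have := mul_le_mul_of_nonneg_left (hQN σ) hτ0
    linarith
  calc _ = ε / n * a * ∑ _σ : (Fin d → Fin (2 ^ r)) → Bool, n / 6 := by
        rw [Finset.mul_sum]
        refine Finset.sum_congr rfl fun σ _ => ?_
        field_simp
    _ ≤ _ := by gcongr

/-- There is a dyadic scale `r` for which `2^(r δ)` is at least `N`, and of the order of `N`. -/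
lemma exists_scale {δ : ℝ} (hδ : 0 < δ) {N : ℕ} (hN : 1 ≤ N) :
    ∃ r : ℕ, (N : ℝ) ≤ 2 ^ (r * δ) ∧ (2 : ℝ) ^ (r : ℝ) ≤ 2 * (N : ℝ) ^ δ⁻¹ := by
  have hN0 : (0 : ℝ) < N := by exact_mod_cast hN
  have hlog : (0 : ℝ) ≤ Real.logb 2 N / δ :=
    div_nonneg (Real.logb_nonneg (by norm_num) (by exact_mod_cast hN)) hδ.le
  refine ⟨⌈Real.logb 2 N / δ⌉₊, ?_, ?_⟩
  · calc (N : ℝ) = 2 ^ Real.logb 2 N := (Real.rpow_logb (by norm_num) (by norm_num) hN0).symm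
      _ ≤ _ := Real.rpow_le_rpow_of_exponent_le (by norm_num)
          ((div_le_iff₀ hδ).1 (Nat.le_ceil _))
  · calc (2 : ℝ) ^ (⌈Real.logb 2 N / δ⌉₊ : ℝ) ≤ 2 ^ (1 + Real.logb 2 N * δ⁻¹) :=
          Real.rpow_le_rpow_of_exponent_le (by norm_num)
            (by rw [add_comm, ← div_eq_mul_inv]; exact (Nat.ceil_lt_add_one hlog).le)
      _ = _ := by
          rw [Real.rpow_add (by norm_num), Real.rpow_one, Real.rpow_mul (by norm_num),
            Real.rpow_logb (by norm_num) (by norm_num) hN0]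

end ActiveLearning

end

theorem theorem1 (d : ℕ) (β γ : ℝ) (hβ : 0 < β) (hγ : 0 < γ) (hβγ : β * γ ≤ d)
    (K : ℝ) (hK : 0 < K) :
    ∃ B₀ : ℝ, ∀ B : ℝ, B₀ ≤ B → ∃ C : ℝ, 0 < C ∧ ∃ N₀ : ℕ, ∀ N : ℕ, N₀ ≤ N →
      -- the active classifier may depend on the marginal distribution
      ∀ A : Measure (ActiveLearning.Cube d) → ActiveLearning.ActiveClassifier d N,
        C * (N : ℝ) ^ (-(β * (1 + γ) / (2 * β + d - β * γ))) ≤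
          ⨆ P : ActiveLearning.classPUStar d β γ B K,
            ((A P.1.marginal).expectedRisk P.1 - P.1.bayesRisk) := by
  open ActiveLearning in
  have hd : 0 < d := by
    have : (0 : ℝ) < d := (mul_pos hβ hγ).trans_le hβγ
    exact_mod_cast this
  obtain ⟨c₀, hc₀, hHolder⟩ := exists_isHolderClass_regFun d hβ hK
  set c := min c₀ (1 / 4) with hc
  have hc0 : 0 < c := lt_min hc₀ (by norm_num)
  have hc4 : c ≤ 1 / 4 := min_le_right _ _
  set δ := 2 * β + d - β * γ with hδ
  have hδ0 : 0 < δ := by linarith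
  refine ⟨c ^ (-γ), fun B hB => ⟨c / 12 * 2 ^ (-(β * (1 + γ))), by positivity, 1,
    fun N hN A => ?_⟩⟩
  have hN0 : (0 : ℝ) < N := by exact_mod_cast hN
  obtain ⟨r, hr1, hr2⟩ := exists_scale hδ0 hN
  set s : ℝ := 2 ^ (-(r * β)) with hs
  have hs0 : 0 < s := by positivity
  have hs1 : s ≤ 1 := Real.rpow_le_one_of_one_le_of_nonpos (by norm_num)
    (by have : 0 ≤ r * β := by positivity
        linarith)
  have hsγ : s ^ γ ≤ 1 := Real.rpow_le_one hs0.le hs1 hγ.le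
  have ha0 : 0 < c * s := by positivity
  have hac : c * s ≤ c := mul_le_of_le_one_right hc0.le hs1
  have hmodel := exists_hardModel hd r (ε := s ^ γ / 2) ha0.le hc0.le (by linarith) (by positivity)
    (by linarith)
  choose P hη hP using hmodel
  have hmem (σ : (Fin d → Fin (2 ^ r)) → Bool) : P σ ∈ classPUStar d β γ B K := by
    refine (hP σ).mem_classPUStar ?_ fun t ht => sum_hardWeight_le hc0 hs0 hs1 hγ hB σ ht
    rw [hη]
    exact hHolder c hc0.le (min_le_left _ _) r _ fun i => (abs_boolSign _).le
  -- `N` is at most `2^(r δ)`, and thus of smaller order than the number `2^(r d)` of bumps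
  -- divided by the information `a²` in a label
  have hfew : 16 / 3 * (c * s) ^ 2 * N ≤ 2 ^ (r * d) / 2 := by
    have h1 : s ^ 2 * N ≤ 2 ^ (r * d) := by
      calc s ^ 2 * N ≤ s ^ 2 * 2 ^ (r * δ) := by gcongr
        _ = 2 ^ (r * (d - β * γ)) := by
            rw [hs, ← Real.rpow_natCast, ← Real.rpow_mul (by norm_num),
              ← Real.rpow_add (by norm_num)]
            congr 1
            push_cast
            rw [hδ]
            ring
        _ ≤ 2 ^ ((r * d : ℕ) : ℝ) := by
            refine Real.rpow_le_rpow_of_exponent_le (by norm_num) ?_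
            push_cast
            gcongr
            linarith [mul_pos hβ hγ]
        _ = _ := Real.rpow_natCast _ _
    have h2 : c ^ 2 ≤ 1 / 16 := by
      calc c ^ 2 ≤ (1 / 4) ^ 2 := by gcongr
        _ = _ := by norm_num
    calc 16 / 3 * (c * s) ^ 2 * N = 16 / 3 * c ^ 2 * (s ^ 2 * N) := by ring
      _ ≤ 16 / 3 * (1 / 16) * 2 ^ (r * d) := by gcongr
      _ ≤ _ := by
          have : (0 : ℝ) < 2 ^ (r * d) := by positivity
          linarith
  -- all models have the same marginal, so that the same classifier is used for all of them
  set μ := cellMixture (hardWeight d r (s ^ γ / 2)) (hardCell d r) with hμ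
  have hlower := le_sum_excessRisk ha0 hc0 (by linarith) (by positivity) hη hP (A μ) hfew
  obtain ⟨σ, -, hσ⟩ := Finset.exists_le_of_sum_le Finset.univ_nonempty hlower
  have hbdd : BddAbove (range fun P : classPUStar d β γ B K =>
      ((A P.1.marginal).expectedRisk P.1 - P.1.bayesRisk)) := by
    refine ⟨1, ?_⟩
    rintro _ ⟨P, rfl⟩
    exact expectedRisk_sub_bayesRisk_le_one _ _
  refine le_trans ?_ (le_ciSup hbdd ⟨P σ, hmem σ⟩)
  simp only
  rw [(hP σ).marginal_eq]
  refine le_trans ?_ hσ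
  have hrate : 2 ^ (-(β * (1 + γ))) * (N : ℝ) ^ (-(β * (1 + γ) / δ)) ≤ s ^ γ * s := by
    have h1 : s ^ γ * s = ((2 : ℝ) ^ (r : ℝ)) ^ (-(β * (1 + γ))) := by
      rw [← Real.rpow_add_one hs0.ne', hs, ← Real.rpow_mul (by norm_num),
        ← Real.rpow_mul (by norm_num)]
      congr 1
      ring
    have h2 : 2 ^ (-(β * (1 + γ))) * (N : ℝ) ^ (-(β * (1 + γ) / δ)) =
        (2 * (N : ℝ) ^ δ⁻¹) ^ (-(β * (1 + γ))) := by
      rw [Real.mul_rpow (by norm_num) (by positivity), ← Real.rpow_mul hN0.le]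
      congr 2
      ring
    rw [h1, h2]
    exact Real.rpow_le_rpow_of_nonpos (by positivity) hr2
      (by have : 0 < β * (1 + γ) := by positivity
          linarith)
  calc _ = c / 12 * (2 ^ (-(β * (1 + γ))) * (N : ℝ) ^ (-(β * (1 + γ) / δ))) := by ring
    _ ≤ c / 12 * (s ^ γ * s) := by gcongr
    _ = _ := by ring
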